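/- **Setting.** Let $\zeta$ be real-analytic on a neighbourhood of $[0,\infty)$ with $-1<\zeta(x)<0$ for $x>0$, and let $c_0\in\mathbb R$. For $L>0$ and $u\in H^4(0,L)$ let $$\mu(u)=-u_{xx}+(u+c_0)^3-(u+c_0)+\zeta\in H^2(0,L),\qquad \mathcal F(u,\beta)=\mu(u)_{xx}-\beta u_x\in L^2(0,L),$$ $$X=\{u\in H^4(0,L): u(0)=u_x(L)=0,\ \mu(u)(0)=\mu(u)_x(L)=0\}.$$ A *steady state* for the coefficient $\beta$ is a $u\in X$ with $\mathcal F(u,\beta)=0$. The set $X$ is an affine space with direction $X_0=\{h\in H^4(0,L):h(0)=h_x(L)=h_{xx}(0)=h_{xxx}(L)=0\}$. For $L>0$ and $z\in\mathbb R$ let $\tilde v(\cdot\,;L,z)$ be the solution of $-\tilde v_{yy}+L^2(\tilde v^3-\tilde v+\zeta(Ly))=0$, $\tilde v(0)=c_0$, $\tilde v_y(0)=z$, and let $f(L,z)=\tilde v_y(1;L,z)$ for all $(L,z)$ for which this solution exists on $[0,1]$. Let $$E=\{L>0:\ \exists z,\ f(L,z)=0 \text{ and } \partial_z f(L,z)=0\}.$$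 **Theorem (small-$\beta$ continuation).** Let $L>0$, $L\notin E$, and let $u\in X$ be a steady state for $\beta=0$. Then: 1. The linearized operator at $u$ has trivial kernel: if $h\in H^2(0,L)$, $h(0)=h_x(L)=0$ and $-h_{xx}+(3(u+c_0)^2-1)h=0$, then $h=0$. Moreover $h\mapsto\mathcal F(u+h,0)$, $X_0\to L^2(0,L)$, is Fréchet differentiable at $h=0$, with derivative $D_u\mathcal F(u,0)h=\big(-h_{xx}+(3(u+c_0)^2-1)h\big)_{xx}$, and $D_u\mathcal F(u,0)\colon X_0\to L^2(0,L)$ has trivial kernel and is an isomorphism of Banach spaces. 2. There are $\beta_0>0$, a $C^1$ map $(-\beta_0,\beta_0)\ni\beta\mapsto u_\beta\in H^4(0,L)$ and $C>0$ such that $u_0=u$ and, for all $|\beta|<\beta_0$, $u_\beta\in X$, $\mathcal F(u_\beta,\beta)=0$, and $$\|u_\beta-u\|_{H^4(0,L)}\le C|\beta|.$$ -/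

import Mathlib

open MeasureTheory Set
open scoped ContDiff ENNReal

noncomputable section

namespace LangmuirBlodgett

/-- Lebesgue measure on the interval `(0, L)`. -/
abbrev vol (L : ℝ) : Measure ℝ := volume.restrict (Ioo 0 L)

/-- The real Hilbert space `L²(0, L)`. -/
abbrev L2 (L : ℝ) := Lp ℝ 2 (vol L)

/-- `φ ∈ C_c^∞(0, L)`. -/
structure IsTest (L : ℝ) (φ : ℝ → ℝ) : Prop where
  smooth : ContDiff ℝ ∞ φ
  compact : HasCompactSupport φ
  support : tsupport φ ⊆ Ioo 0 L

/-- `g` is the weak derivative of `f` on `(0, L)`. -/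
def HasWeakDeriv (L : ℝ) (f g : ℝ → ℝ) : Prop :=
  ∀ φ : ℝ → ℝ, IsTest L φ →
    ∫ x, f x * deriv φ x ∂(vol L) = - ∫ x, g x * φ x ∂(vol L)

lemma IsTest.deriv {L : ℝ} {φ : ℝ → ℝ} (h : IsTest L φ) : IsTest L (deriv φ) :=
  ⟨(contDiff_infty_iff_deriv.1 h.smooth).2, h.compact.deriv,
    (closure_minimal support_deriv_subset (isClosed_tsupport φ)).trans h.support⟩

lemma memLp_of_continuousOn {L : ℝ} {f : ℝ → ℝ} (hf : ContinuousOn f (Icc 0 L)) (p : ℝ≥0∞) :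
    MemLp f p (vol L) := by
  obtain ⟨C, hC⟩ := isCompact_Icc.exists_bound_of_continuousOn hf
  refine MemLp.of_bound ((hf.mono Ioo_subset_Icc_self).aestronglyMeasurable measurableSet_Ioo) C ?_
  filter_upwards [ae_restrict_mem measurableSet_Ioo] with x hx
  exact hC x (Ioo_subset_Icc_self hx)

lemma integrable_mul_test {L : ℝ} {f φ : ℝ → ℝ} (hf : MemLp f 2 (vol L)) (hφ : IsTest L φ) :
    Integrable (fun x => f x * φ x) (vol L) :=
  MemLp.integrable_mul hf (memLp_of_continuousOn hφ.smooth.continuous.continuousOn 2)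

lemma HasWeakDeriv.congr {L : ℝ} {f g f' g' : ℝ → ℝ} (h : HasWeakDeriv L f g)
    (hf : f' =ᵐ[vol L] f) (hg : g' =ᵐ[vol L] g) : HasWeakDeriv L f' g' := by
  intro φ hφ
  have e1 : ∫ x, f' x * deriv φ x ∂(vol L) = ∫ x, f x * deriv φ x ∂(vol L) :=
    integral_congr_ae (by filter_upwards [hf] with x hx; rw [hx])
  have e2 : ∫ x, g' x * φ x ∂(vol L) = ∫ x, g x * φ x ∂(vol L) :=
    integral_congr_ae (by filter_upwards [hg] with x hx; rw [hx])
  rw [e1, e2]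
  exact h φ hφ

lemma hasWeakDeriv_zero (L : ℝ) : HasWeakDeriv L 0 0 := by
  intro φ _; simp

lemma HasWeakDeriv.add {L : ℝ} {f g f' g' : ℝ → ℝ} (h : HasWeakDeriv L f g)
    (h' : HasWeakDeriv L f' g') (hf : MemLp f 2 (vol L)) (hg : MemLp g 2 (vol L))
    (hf' : MemLp f' 2 (vol L)) (hg' : MemLp g' 2 (vol L)) :
    HasWeakDeriv L (f + f') (g + g') := by
  intro φ hφ
  simp only [Pi.add_apply, add_mul]
  rw [integral_add (integrable_mul_test hf hφ.deriv) (integrable_mul_test hf' hφ.deriv),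
    integral_add (integrable_mul_test hg hφ) (integrable_mul_test hg' hφ), h φ hφ, h' φ hφ]
  ring

lemma HasWeakDeriv.smul {L : ℝ} {f g : ℝ → ℝ} (c : ℝ) (h : HasWeakDeriv L f g) :
    HasWeakDeriv L (c • f) (c • g) := by
  intro φ hφ
  simp only [Pi.smul_apply, smul_eq_mul, mul_assoc, integral_const_mul]
  rw [h φ hφ]; ring

lemma hasWeakDeriv_of_ac {L : ℝ} (hL : 0 < L) {F g : ℝ → ℝ}
    (hF : AbsolutelyContinuousOnInterval F 0 L) (hg : deriv F =ᵐ[vol L] g) :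
    HasWeakDeriv L F g := by
  refine HasWeakDeriv.congr (f := F) (g := deriv F) ?_ (ae_eq_refl _) hg.symm
  intro φ hφ
  have hφac : AbsolutelyContinuousOnInterval φ 0 L :=
    ((hφ.smooth.of_le (by norm_num)).contDiffOn).absolutelyContinuousOnInterval
  have key := hF.integral_mul_deriv_eq_deriv_mul hφac
  have h0 : φ 0 = 0 := image_eq_zero_of_notMem_tsupport fun h => by simpa using (hφ.support h).1
  have h1 : φ L = 0 := image_eq_zero_of_notMem_tsupport fun h => by simpa using (hφ.support h).2
  rw [intervalIntegral.integral_of_le hL.le, intervalIntegral.integral_of_le hL.le,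
    integral_Ioc_eq_integral_Ioo, integral_Ioc_eq_integral_Ioo, h0, h1] at key
  simpa using key

/-- A function with vanishing weak derivative is constant. -/
lemma ae_const_of_weakDeriv_zero {L : ℝ} (hL : 0 < L) {d : ℝ → ℝ} (hd : MemLp d 2 (vol L))
    (h : ∀ φ, IsTest L φ → ∫ x, d x * deriv φ x ∂(vol L) = 0) :
    ∃ c : ℝ, ∀ᵐ x ∂(vol L), d x = c := by
  obtain ⟨ρ, hρ, hρ1⟩ : ∃ ρ, IsTest L ρ ∧ ∫ x, ρ x ∂(vol L) = 1 := by
    obtain ⟨f, hfs, hfc, hfd, hfr, hf1⟩ := exists_contDiff_tsupport_subset (n := ⊤)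
      (Ioo_mem_nhds (show (0 : ℝ) < L / 2 by linarith) (show L / 2 < L by linarith))
    have hpos : 0 < ∫ x, f x ∂(vol L) := by
      rw [setIntegral_eq_integral_of_forall_compl_eq_zero
        (fun x hx => image_eq_zero_of_notMem_tsupport fun h => hx (hfs h))]
      refine (hfd.continuous).integral_pos_of_hasCompactSupport_nonneg_nonzero hfc
        (fun x => (hfr ⟨x, rfl⟩).1) (x := L / 2) (by rw [hf1]; norm_num)
    refine ⟨fun x => (∫ x, f x ∂(vol L))⁻¹ * f x, ⟨contDiff_const.mul hfd, hfc.mul_left,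
      (closure_mono (Function.support_mul_subset_right _ _)).trans hfs⟩, ?_⟩
    rw [integral_const_mul, inv_mul_cancel₀ hpos.ne']
  refine ⟨∫ x, d x * ρ x ∂(vol L), ?_⟩
  set c := ∫ x, d x * ρ x ∂(vol L) with hc
  have hd1 : IntegrableOn d (Ioo 0 L) := hd.integrable (by norm_num)
  have hdc : IntegrableOn (fun x => d x - c) (Ioo 0 L) :=
    hd1.sub (integrable_const c)
  rw [ae_restrict_iff' measurableSet_Ioo]
  have := isOpen_Ioo.ae_eq_zero_of_integral_contDiff_smul_eq_zero
    (U := Ioo (0 : ℝ) L) (μ := volume) (f := fun x => d x - c) hdc.locallyIntegrableOn ?_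
  · filter_upwards [this] with x hx hxL
    exact sub_eq_zero.1 (hx hxL)
  intro ψ hψ1 hψ2 hψ3
  have hψ : IsTest L ψ := ⟨hψ1, hψ2, hψ3⟩
  rw [← setIntegral_eq_integral_of_forall_compl_eq_zero (s := Ioo 0 L) (fun x hx => by
    rw [image_eq_zero_of_notMem_tsupport fun h => hx (hψ3 h), zero_smul])]
  set a := ∫ x, ψ x ∂(vol L) with ha
  set η : ℝ → ℝ := fun x => ψ x - a * ρ x with hη
  have hηc : Continuous η := by
    have := hψ1.continuous; have := hρ.smooth.continuous; fun_prop
  have hη0 : ∫ x, η x ∂(vol L) = 0 := by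
    have i1 : Integrable ψ (vol L) :=
      (memLp_of_continuousOn hψ1.continuous.continuousOn 1).integrable le_rfl
    have i2 : Integrable ρ (vol L) :=
      (memLp_of_continuousOn hρ.smooth.continuous.continuousOn 1).integrable le_rfl
    simp only [hη]
    rw [integral_sub i1 (i2.const_mul a), integral_const_mul, hρ1]; simp [ha]
  obtain ⟨p, q, hp, hpq, hq, hK⟩ : ∃ p q : ℝ, 0 < p ∧ p ≤ q ∧ q < L ∧
      tsupport ψ ∪ tsupport ρ ⊆ Icc p q := by
    have hKc : IsCompact ((tsupport ψ ∪ tsupport ρ) ∪ {L / 2}) :=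
      (hψ2.isCompact.union hρ.compact.isCompact).union isCompact_singleton
    have hne : ((tsupport ψ ∪ tsupport ρ) ∪ {L / 2}).Nonempty := ⟨L / 2, by simp⟩
    have hsub : (tsupport ψ ∪ tsupport ρ) ∪ {L / 2} ⊆ Ioo 0 L :=
      union_subset (union_subset hψ3 hρ.support)
        (by rw [singleton_subset_iff]; constructor <;> linarith)
    obtain ⟨p, hp⟩ := hKc.exists_isLeast hne
    obtain ⟨q, hq⟩ := hKc.exists_isGreatest hne
    exact ⟨p, q, (hsub hp.1).1, hp.2 hq.1, (hsub hq.1).2,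
      fun x hx => ⟨hp.2 (Or.inl hx), hq.2 (Or.inl hx)⟩⟩
  have hηz : ∀ x, x ∉ Icc p q → η x = 0 := by
    intro x hx
    have h1 : ψ x = 0 := image_eq_zero_of_notMem_tsupport fun h => hx (hK (Or.inl h))
    have h2 : ρ x = 0 := image_eq_zero_of_notMem_tsupport fun h => hx (hK (Or.inr h))
    simp [hη, h1, h2]
  set φ : ℝ → ℝ := fun x => ∫ t in (0 : ℝ)..x, η t with hφdef
  have hφd : ∀ x, HasDerivAt φ (η x) x := fun x =>
    intervalIntegral.integral_hasDerivAt_right (hηc.intervalIntegrable _ _)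
      (hηc.stronglyMeasurableAtFilter volume _) hηc.continuousAt
  have hφ' : deriv φ = η := funext fun x => (hφd x).deriv
  have hφsupp : Function.support φ ⊆ Icc p q := by
    intro x hx
    by_contra hxn
    apply hx
    rcases lt_or_ge x p with h | h
    · show ∫ t in (0 : ℝ)..x, η t = 0
      refine intervalIntegral.integral_zero_ae (Filter.Eventually.of_forall fun t ht => hηz t ?_)
      rw [uIoc, mem_Ioc] at ht
      intro htt
      rcases le_or_gt 0 x with h0 | h0
      · rw [max_eq_right h0] at ht; linarith [ht.2, htt.1]
      · rw [max_eq_left h0.le] at ht; linarith [ht.2, htt.1]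
    · have hxq : q < x := by by_contra hh; exact hxn ⟨h, not_lt.1 hh⟩
      have e1 : ∫ t in (0 : ℝ)..L, η t = 0 := by
        rw [intervalIntegral.integral_of_le hL.le, integral_Ioc_eq_integral_Ioo]; exact hη0
      have e2 : ∫ t in x..L, η t = 0 := by
        refine intervalIntegral.integral_zero_ae (Filter.Eventually.of_forall fun t ht => hηz t ?_)
        intro htt
        rw [uIoc, mem_Ioc] at ht
        have := lt_min hxq hq
        linarith [ht.1, htt.2]
      have e3 := intervalIntegral.integral_add_adjacent_intervals
        (hηc.intervalIntegrable (μ := volume) 0 x) (hηc.intervalIntegrable x L)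
      show ∫ t in (0 : ℝ)..x, η t = 0
      linarith
  have hφT : IsTest L φ := by
    refine ⟨?_, HasCompactSupport.of_support_subset_isCompact isCompact_Icc hφsupp, ?_⟩
    · rw [contDiff_infty_iff_deriv, hφ']
      exact ⟨fun x => (hφd x).differentiableAt, hψ1.sub (contDiff_const.mul hρ.smooth)⟩
    · exact (closure_minimal hφsupp isClosed_Icc).trans
        fun x hx => ⟨hp.trans_le hx.1, hx.2.trans_lt hq⟩
  have h0 := h φ hφT
  rw [hφ'] at h0
  have i1 := integrable_mul_test hd hψ
  have i2 := integrable_mul_test hd hρ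
  have i3 : Integrable ψ (vol L) :=
    (memLp_of_continuousOn hψ1.continuous.continuousOn 1).integrable le_rfl
  have e1 : ∫ x, d x * ψ x ∂(vol L) = a * c := by
    have : (fun x => d x * η x) = fun x => d x * ψ x - a * (d x * ρ x) := by
      funext x; simp only [hη]; ring
    rw [this, integral_sub i1 (i2.const_mul a), integral_const_mul] at h0
    linarith
  have : (fun x => ψ x • (d x - c)) = fun x => d x * ψ x - c * ψ x := by
    funext x; simp only [smul_eq_mul]; ring
  rw [this, integral_sub i1 (i3.const_mul c), integral_const_mul, e1]
  simp only [← ha]; ring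

/-- A function in `H¹(0, L)` has an absolutely continuous representative on `[0, L]`, whose
classical derivative is the weak derivative. -/
lemma exists_ac_rep {L : ℝ} (hL : 0 < L) {f g : ℝ → ℝ} (hf : MemLp f 2 (vol L))
    (hg : MemLp g 2 (vol L)) (h : HasWeakDeriv L f g) :
    ∃ F : ℝ → ℝ, AbsolutelyContinuousOnInterval F 0 L ∧ f =ᵐ[vol L] F ∧ deriv F =ᵐ[vol L] g := by
  have hgi : IntervalIntegrable g volume 0 L := by
    rw [intervalIntegrable_iff_integrableOn_Ioo_of_le hL.le]
    exact hg.integrable (by norm_num)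
  set G : ℝ → ℝ := fun x => ∫ t in (0 : ℝ)..x, g t with hG
  have hGac : AbsolutelyContinuousOnInterval G 0 L :=
    hgi.absolutelyContinuousOnInterval_intervalIntegral (by simp)
  have hGd : deriv G =ᵐ[vol L] g := by
    rw [Filter.EventuallyEq, ae_restrict_iff' measurableSet_Ioo]
    filter_upwards [hgi.ae_hasDerivAt_integral] with x hx hxL
    exact (hx (by rw [uIcc_of_le hL.le]; exact Ioo_subset_Icc_self hxL) 0 (by simp)).deriv
  have hGm : MemLp G 2 (vol L) :=
    memLp_of_continuousOn (by simpa [uIcc_of_le hL.le] using hGac.continuousOn) 2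
  obtain ⟨c, hc⟩ := ae_const_of_weakDeriv_zero hL (hf.sub hGm) (fun φ hφ => by
    have e1 := h φ hφ
    have e2 := hasWeakDeriv_of_ac hL hGac hGd φ hφ
    simp only [Pi.sub_apply, sub_mul]
    rw [integral_sub (integrable_mul_test hf hφ.deriv) (integrable_mul_test hGm hφ.deriv), e1, e2]
    ring)
  have hcac : AbsolutelyContinuousOnInterval (fun _ : ℝ => c) 0 L :=
    (contDiff_const (n := 1)).contDiffOn.absolutelyContinuousOnInterval
  refine ⟨G + fun _ => c, hGac.add hcac, ?_, ?_⟩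
  · filter_upwards [hc] with x hx
    simp only [Pi.sub_apply, Pi.add_apply] at hx ⊢; linarith
  · refine Filter.EventuallyEq.trans (Filter.Eventually.of_forall fun x => ?_) hGd
    show deriv (fun y => G y + c) x = deriv G x
    simp


/-- The Sobolev space `Hᵐ(0, L)`: tuples `(u, u', …, u⁽ᵐ⁾)` of elements of `L²(0, L)`, each being
the weak derivative of the preceding one, with the norm `(∑ₖ ‖u⁽ᵏ⁾‖²)^(1/2)`. -/
def Sobolev (m : ℕ) (L : ℝ) : Submodule ℝ (PiLp 2 fun _ : Fin (m + 1) => L2 L) where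
  carrier := {u | ∀ k : Fin m, HasWeakDeriv L (u k.castSucc) (u k.succ)}
  zero_mem' _ := (hasWeakDeriv_zero L).congr (Lp.coeFn_zero _ _ _) (Lp.coeFn_zero _ _ _)
  add_mem' {_ _} hu hv k := ((hu k).add (hv k) (Lp.memLp _) (Lp.memLp _) (Lp.memLp _)
    (Lp.memLp _)).congr (Lp.coeFn_add _ _) (Lp.coeFn_add _ _)
  smul_mem' c _ hu k := ((hu k).smul c).congr (Lp.coeFn_smul _ _) (Lp.coeFn_smul _ _)

/-- The `k`-th weak derivative of `u ∈ Hᵐ(0, L)`. -/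
def wd {m : ℕ} {L : ℝ} (u : Sobolev m L) (k : Fin (m + 1)) : L2 L :=
  (u : PiLp 2 fun _ : Fin (m + 1) => L2 L) k

/-- The continuous representative on `[0, L]` of `f` takes the value `c` at the point `a`. -/
def HasBoundaryValue (L : ℝ) (f : ℝ → ℝ) (a c : ℝ) : Prop :=
  ∃ F : ℝ → ℝ, ContinuousOn F (Icc 0 L) ∧ f =ᵐ[vol L] F ∧ F a = c

lemma HasBoundaryValue.congr {L : ℝ} {f f' : ℝ → ℝ} {a c : ℝ} (h : HasBoundaryValue L f a c)
    (hf : f' =ᵐ[vol L] f) : HasBoundaryValue L f' a c := by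
  obtain ⟨F, h1, h2, h3⟩ := h
  exact ⟨F, h1, hf.trans h2, h3⟩

/-- `m = -u_xx + (u + c₀)³ - (u + c₀) + ζ`. -/
def IsChemPot {L : ℝ} (ζ : ℝ → ℝ) (c₀ : ℝ) (u : Sobolev 4 L) (m : Sobolev 2 L) : Prop :=
  wd m 0 =ᵐ[vol L] fun x => - wd u 2 x + (wd u 0 x + c₀) ^ 3 - (wd u 0 x + c₀) + ζ x

/-- The chemical potential of a function in `H⁴(0, L)` belongs to `H²(0, L)`. -/
lemma exists_chemPot {L : ℝ} {ζ : ℝ → ℝ} (hζ : AnalyticOnNhd ℝ ζ (Ici 0)) (c₀ : ℝ)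
    (u : Sobolev 4 L) : ∃ m : Sobolev 2 L, IsChemPot ζ c₀ u m := by
  rcases le_or_gt L 0 with hL | hL
  · have : vol L = 0 := by simp [vol, Ioo_eq_empty (not_lt.2 hL)]
    refine ⟨0, ?_⟩
    have hbot : ae (vol L) = ⊥ := by rw [this, ae_zero]
    rw [IsChemPot, Filter.EventuallyEq, hbot]
    exact Filter.eventually_bot
  have rep : ∀ k : Fin 4, ∃ F : ℝ → ℝ, AbsolutelyContinuousOnInterval F 0 L ∧
      wd u k.castSucc =ᵐ[vol L] F ∧ deriv F =ᵐ[vol L] wd u k.succ := fun k =>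
    exists_ac_rep hL (Lp.memLp _) (Lp.memLp _) (u.2 k)
  obtain ⟨U0, a0, e0, d0⟩ := rep 0
  obtain ⟨U1, a1, e1, d1⟩ := rep 1
  obtain ⟨U2, a2, e2, d2⟩ := rep 2
  obtain ⟨U3, a3, e3, d3⟩ := rep 3
  have hIcc : uIcc 0 L = Icc 0 L := uIcc_of_le hL.le
  have hsub : Icc 0 L ⊆ Ici (0 : ℝ) := Icc_subset_Ici_self
  have az : AbsolutelyContinuousOnInterval ζ 0 L :=
    ContDiffOn.absolutelyContinuousOnInterval
      (by rw [hIcc]; exact (hζ.mono hsub).contDiffOn (uniqueDiffOn_Icc hL))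
  have az' : AbsolutelyContinuousOnInterval (deriv ζ) 0 L :=
    ContDiffOn.absolutelyContinuousOnInterval
      (by rw [hIcc]; exact (hζ.deriv.mono hsub).contDiffOn (uniqueDiffOn_Icc hL))
  have cz'' : ContinuousOn (deriv (deriv ζ)) (Icc 0 L) := hζ.deriv.deriv.continuousOn.mono hsub
  have ac : AbsolutelyContinuousOnInterval (fun _ : ℝ => c₀) 0 L :=
    (contDiff_const (n := 1)).contDiffOn.absolutelyContinuousOnInterval
  have ac1 : AbsolutelyContinuousOnInterval (fun _ : ℝ => (-1 : ℝ)) 0 L :=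
    (contDiff_const (n := 1)).contDiffOn.absolutelyContinuousOnInterval
  have aw := a0.add ac
  set W : ℝ → ℝ := U0 + fun _ => c₀ with hW
  set M0 : ℝ → ℝ := -U2 + W * (W * W) - W + ζ with hM0
  set M1 : ℝ → ℝ := -U3 + ((3 : ℝ) • (W * W) + fun _ => -1) * U1 + deriv ζ with hM1
  have hM0ac : AbsolutelyContinuousOnInterval M0 0 L :=
    ((a2.neg.add (aw.mul (aw.mul aw))).sub aw).add az
  have hM1ac : AbsolutelyContinuousOnInterval M1 0 L :=
    (a3.neg.add ((((aw.mul aw).const_smul (3 : ℝ)).add ac1).mul a1)).add az'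
  set M2 : ℝ → ℝ := fun x => - wd u 4 x +
    (6 * W x * U1 x * U1 x + (3 * W x ^ 2 - 1) * U2 x + deriv (deriv ζ) x) with hM2
  have diff : ∀ {F : ℝ → ℝ}, AbsolutelyContinuousOnInterval F 0 L →
      ∀ᵐ x ∂(vol L), DifferentiableAt ℝ F x := fun {F} hF => by
    rw [ae_restrict_iff' measurableSet_Ioo]
    filter_upwards [hF.ae_differentiableAt] with x hx hxL
    exact hx (by rw [hIcc]; exact Ioo_subset_Icc_self hxL)
  have hxI : ∀ᵐ x ∂(vol L), x ∈ Ioo 0 L := ae_restrict_mem measurableSet_Ioo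
  have dM0 : deriv M0 =ᵐ[vol L] M1 := by
    filter_upwards [diff a0, diff a2, d0, d2, e1, e3, hxI] with x h0 h2 k0 k2 k1 k3 hx
    have hd0 : HasDerivAt U0 (U1 x) x := by
      have := h0.hasDerivAt; rw [k0] at this; exact (k1 ▸ this)
    have hd2 : HasDerivAt U2 (U3 x) x := by
      have := h2.hasDerivAt; rw [k2] at this; exact (k3 ▸ this)
    have hw : HasDerivAt W (U1 x) x := by simpa using hd0.add (hasDerivAt_const x c₀)
    have hz : HasDerivAt ζ (deriv ζ x) x := (hζ x hx.1.le).differentiableAt.hasDerivAt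
    rw [(((hd2.neg.add (hw.mul (hw.mul hw))).sub hw).add hz).deriv]
    simp [hM1]; ring
  have dM1 : deriv M1 =ᵐ[vol L] M2 := by
    filter_upwards [diff a0, diff a1, diff a3, d0, d1, d3, e1, e2, hxI]
      with x h0 h1 h3 k0 k1 k3 l1 l2 hx
    have hd0 : HasDerivAt U0 (U1 x) x := by
      have := h0.hasDerivAt; rw [k0] at this; exact (l1 ▸ this)
    have hd1 : HasDerivAt U1 (U2 x) x := by
      have := h1.hasDerivAt; rw [k1] at this; exact (l2 ▸ this)
    have hd3 : HasDerivAt U3 (wd u 4 x) x := by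
      have := h3.hasDerivAt; rw [k3] at this; exact this
    have hw : HasDerivAt W (U1 x) x := by simpa using hd0.add (hasDerivAt_const x c₀)
    have hz : HasDerivAt (deriv ζ) (deriv (deriv ζ) x) x :=
      (hζ.deriv x hx.1.le).differentiableAt.hasDerivAt
    rw [((hd3.neg.add ((((hw.mul hw).const_smul (3 : ℝ)).add
      (hasDerivAt_const x (-1 : ℝ))).mul hd1)).add hz).deriv]
    simp [hM2]; ring
  have cont : ∀ {F : ℝ → ℝ}, AbsolutelyContinuousOnInterval F 0 L → ContinuousOn F (Icc 0 L) :=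
    fun hF => hIcc ▸ hF.continuousOn
  have m0 : MemLp M0 2 (vol L) := memLp_of_continuousOn (cont hM0ac) 2
  have m1 : MemLp M1 2 (vol L) := memLp_of_continuousOn (cont hM1ac) 2
  have m2 : MemLp M2 2 (vol L) := by
    refine (Lp.memLp (wd u 4)).neg.add (memLp_of_continuousOn ?_ 2)
    have := cont aw; have := cont a1; have := cont a2
    fun_prop
  refine ⟨⟨WithLp.toLp 2 ![m0.toLp M0, m1.toLp M1, m2.toLp M2], ?_⟩, ?_⟩
  · intro k
    fin_cases k
    · exact (hasWeakDeriv_of_ac hL hM0ac dM0).congr m0.coeFn_toLp m1.coeFn_toLp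
    · exact (hasWeakDeriv_of_ac hL hM1ac dM1).congr m1.coeFn_toLp m2.coeFn_toLp
  · show m0.toLp M0 =ᵐ[vol L] _
    filter_upwards [m0.coeFn_toLp, e0, e2] with x hx k0 k2
    have k0' : wd u 0 x = U0 x := k0
    have k2' : wd u 2 x = U2 x := k2
    rw [hx, k0', k2']
    simp [hM0, hW]; ring

/-- The chemical potential `μ(u) = -u_xx + (u + c₀)³ - (u + c₀) + ζ ∈ H²(0, L)` of
`u ∈ H⁴(0, L)`. -/
def chemPot {L : ℝ} {ζ : ℝ → ℝ} (hζ : AnalyticOnNhd ℝ ζ (Ici 0)) (c₀ : ℝ) (u : Sobolev 4 L) :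
    Sobolev 2 L :=
  (exists_chemPot hζ c₀ u).choose

/-- The operator `𝓕(u, β) = (-u_xx + (u + c₀)³ - (u + c₀) + ζ)_xx - β u_x ∈ L²(0, L)`. -/
def steadyOp {L : ℝ} {ζ : ℝ → ℝ} (hζ : AnalyticOnNhd ℝ ζ (Ici 0)) (c₀ : ℝ) (u : Sobolev 4 L)
    (β : ℝ) : L2 L :=
  wd (chemPot hζ c₀ u) 2 - β • wd u 1

/-- The set `X` of all `u ∈ H⁴(0, L)` with `u(0) = u_x(L) = μ(0) = μ_x(L) = 0`, `μ = μ(u)`. -/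
def stateSpace (L : ℝ) {ζ : ℝ → ℝ} (hζ : AnalyticOnNhd ℝ ζ (Ici 0)) (c₀ : ℝ) :
    Set (Sobolev 4 L) :=
  {u | HasBoundaryValue L (wd u 0) 0 0 ∧ HasBoundaryValue L (wd u 1) L 0 ∧
    HasBoundaryValue L (wd (chemPot hζ c₀ u) 0) 0 0 ∧
    HasBoundaryValue L (wd (chemPot hζ c₀ u) 1) L 0}

/-- `u` is a steady state of the problem with advection coefficient `β`. -/
def IsSteadyState {L : ℝ} {ζ : ℝ → ℝ} (hζ : AnalyticOnNhd ℝ ζ (Ici 0)) (c₀ β : ℝ)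
    (u : Sobolev 4 L) : Prop :=
  u ∈ stateSpace L hζ c₀ ∧ steadyOp hζ c₀ u β = 0

lemma HasBoundaryValue.add {L : ℝ} {f g : ℝ → ℝ} {a c d : ℝ} (hf : HasBoundaryValue L f a c)
    (hg : HasBoundaryValue L g a d) : HasBoundaryValue L (f + g) a (c + d) := by
  obtain ⟨F, h1, h2, h3⟩ := hf
  obtain ⟨G, k1, k2, k3⟩ := hg
  exact ⟨F + G, h1.add k1, h2.add k2, by simp [h3, k3]⟩

lemma HasBoundaryValue.smul {L : ℝ} {f : ℝ → ℝ} {a c : ℝ} (r : ℝ)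
    (hf : HasBoundaryValue L f a c) : HasBoundaryValue L (r • f) a (r * c) := by
  obtain ⟨F, h1, h2, h3⟩ := hf
  exact ⟨r • F, h1.const_smul r, h2.const_smul r, by simp [h3]⟩

/-- The functions in `Hᵐ(0, L)` satisfying the homogeneous boundary conditions `h⁽ᵏ⁾(a) = 0` for
all `(k, a) ∈ B`. -/
def homogeneousSpace (m : ℕ) (L : ℝ) (B : Set (Fin (m + 1) × ℝ)) : Submodule ℝ (Sobolev m L) where
  carrier := {h | ∀ p ∈ B, HasBoundaryValue L (wd h p.1) p.2 0}
  zero_mem' p _ := HasBoundaryValue.congr (f := 0)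
    ⟨0, continuousOn_const, ae_eq_refl _, rfl⟩ (Lp.coeFn_zero _ _ _)
  add_mem' {_ _} hu hv p hp := by
    have := ((hu p hp).add (hv p hp)).congr (Lp.coeFn_add _ _)
    rw [add_zero] at this
    exact this
  smul_mem' c _ hu p hp := by
    have := ((hu p hp).smul c).congr (Lp.coeFn_smul c _)
    rw [mul_zero] at this
    exact this

/-- The function `-h_xx + (3 (u + c₀)² - 1) h`, given `h` and its second derivative `h₂`. -/
def linPot {L : ℝ} (c₀ : ℝ) (u : Sobolev 4 L) (h h₂ : ℝ → ℝ) : ℝ → ℝ :=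
  fun x => - h₂ x + (3 * (wd u 0 x + c₀) ^ 2 - 1) * h x

/-- The domain `{h ∈ H²(0, L) : h(0) = h_x(L) = 0}` of the second order linearized operator. -/
abbrev domain₂ (L : ℝ) : Submodule ℝ (Sobolev 2 L) := homogeneousSpace 2 L {(0, 0), (1, L)}

/-- The tangent space `{h ∈ H⁴(0, L) : h(0) = h_x(L) = h_xx(0) = h_xxx(L) = 0}` of the space `X`.
Since `u(0) = 0` and `u_x(L) = 0` for `u ∈ X`, the conditions `μ(0) = 0` and `μ_x(L) = 0` read
`u_xx(0) = c₀³ - c₀ + ζ(0)` and `u_xxx(L) = ζ_x(L)`, so that `X` is an affine space with this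
direction. -/
abbrev tangentSpace (L : ℝ) : Submodule ℝ (Sobolev 4 L) :=
  homogeneousSpace 4 L {(0, 0), (1, L), (2, 0), (3, L)}

/-- `v` (with derivative `w`) is the solution on `[0, 1]` of the initial value problem
`-v_yy + L² (v³ - v + ζ(L y)) = 0`, `v(0) = c₀`, `v_y(0) = z`. -/
structure IsShootingSolution (ζ : ℝ → ℝ) (c₀ L z : ℝ) (v w : ℝ → ℝ) : Prop where
  hasDeriv : ∀ y ∈ Icc (0 : ℝ) 1, HasDerivWithinAt v (w y) (Icc 0 1) y
  ode : ∀ y ∈ Icc (0 : ℝ) 1,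
    HasDerivWithinAt w (L ^ 2 * (v y ^ 3 - v y + ζ (L * y))) (Icc 0 1) y
  init : v 0 = c₀
  init_deriv : w 0 = z

/-- The initial value problem with initial slope `z` has a solution on the whole of `[0, 1]`. -/
def Shootable (ζ : ℝ → ℝ) (c₀ L z : ℝ) : Prop := ∃ v w, IsShootingSolution ζ c₀ L z v w

open Classical in
/-- The shooting function `f(L, z) = v_y(1; L, z)`; it is meaningful for those `z` for which the
solution exists on `[0, 1]`, which form an open set. -/
def shoot (ζ : ℝ → ℝ) (c₀ L z : ℝ) : ℝ :=
  if h : Shootable ζ c₀ L z then h.choose_spec.choose 1 else 0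

/-- `z` is a zero of the shooting function `f(L, ·)`. -/
def IsShootingZero (ζ : ℝ → ℝ) (c₀ L z : ℝ) : Prop := Shootable ζ c₀ L z ∧ shoot ζ c₀ L z = 0

/-- The zero `z` of `f(L, ·)` is degenerate: `∂_z f(L, z) = 0`. -/
def IsBranchPoint (ζ : ℝ → ℝ) (c₀ L z : ℝ) : Prop :=
  IsShootingZero ζ c₀ L z ∧ HasDerivAt (fun s => shoot ζ c₀ L s) 0 z

/-- The set `E` of exceptional lengths. -/
def exceptionalSet (ζ : ℝ → ℝ) (c₀ : ℝ) : Set ℝ := {L | 0 < L ∧ ∃ z, IsBranchPoint ζ c₀ L z}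

end LangmuirBlodgett

end

noncomputable section

namespace LangmuirBlodgett

/-! At `β = 0` the fourth order problem collapses: `μ(u)` is affine, and its two boundary conditions
force `μ(u) = 0`. Hence `v = u + c₀` solves `v_xx = v³ - v + ζ`, `v(0) = c₀`, `v_x(L) = 0`, and
after the rescaling `x = L y` the slope `z = L u_x(0)` is a zero of `f(L, ·)`. Put `q = 3 v² - 1`
and let `φ` solve `φ_xx = q φ`, `φ(0) = 0`, `φ_x(0) = 1`. Differentiating the initial value problem
in its slope gives `∂_z f(L, z) = φ_x(L)` (`hasDerivAt_shoot`), so `L ∉ E` yields `φ_x(L) ≠ 0`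
(`endpoint_slope_ne_zero`).

This number decides everything. A kernel element `h` of `-∂_xx + q` with `h(0) = 0` is `h_x(0) φ`,
and `h_x(L) = 0` kills it. The full linearization is `∂_xx ∘ (-∂_xx + q)`, and since `q_x(L) = 0`
the boundary conditions of `X₀` split between the two factors. It is therefore inverted by solving
two second order problems in succession (`linOp_injective`, `linOp_surjective`). The branch then
comes from the implicit function theorem on `ℝ × X₀` (`exists_implicit_branch`).

Initial value problems are treated as integral equations in `C[0, L]`. The double-integral Volterra
operator of `q` has a power of norm less than one, so `1 - volterra q` is invertible, and `φ = (1 -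
volterra q)⁻¹ x`. -/

/-- The Banach algebra of continuous functions on `[0, L]`. -/
abbrev CI (L : ℝ) := C(Icc (0 : ℝ) L, ℝ)

/-! ### Calculus and Volterra equations in `C[0, L]` -/

section CI

variable {L : ℝ}

/-- Hölder's inequality on a finite measure space; for `L > 0` the constant is `√L`. It bounds the
operator `prim`. -/
lemma integral_norm_L2_le (g : L2 L) :
    ∫ x, ‖g x‖ ∂(vol L) ≤
      ‖g‖ * (vol L univ ^ (1 / (1 : ℝ≥0∞).toReal - 1 / (2 : ℝ≥0∞).toReal)).toReal := by
  have hg := Lp.memLp g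
  rw [integral_norm_eq_lintegral_enorm hg.1, ← eLpNorm_one_eq_lintegral_enorm, Lp.norm_def,
    ← ENNReal.toReal_mul]
  refine ENNReal.toReal_mono (ENNReal.mul_ne_top hg.2.ne ?_)
    (eLpNorm_le_eLpNorm_mul_rpow_measure_univ (by norm_num) hg.1)
  exact ENNReal.rpow_ne_top_of_nonneg (by norm_num) (measure_ne_top _ _)

lemma intervalIntegral_congr_vol {f g : ℝ → ℝ} (h : f =ᵐ[vol L] g) {x y : ℝ} (hx : x ∈ Icc 0 L)
    (hy : y ∈ Icc 0 L) : ∫ t in x..y, f t = ∫ t in x..y, g t := by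
  refine intervalIntegral.integral_congr_ae_restrict ?_
  have h' : f =ᵐ[volume.restrict (Ioc 0 L)] g := by rwa [← restrict_Ioo_eq_restrict_Ioc]
  refine ae_restrict_of_ae_restrict_of_subset ?_ h'
  intro t ht
  exact ⟨(le_min hx.1 hy.1).trans_lt ht.1, ht.2.trans (max_le hx.2 hy.2)⟩

variable [hL : Fact (0 < L)]

/-- The extension of a continuous function on `[0, L]` to the real line by constants. -/
def extend (f : CI L) : ℝ → ℝ := IccExtend hL.out.le f

lemma continuous_extend (f : CI L) : Continuous (extend f) := f.continuous.Icc_extend'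

lemma extend_apply (f : CI L) (x : Icc (0 : ℝ) L) : extend f x = f x :=
  IccExtend_val _ _ _

lemma extend_of_mem (f : CI L) {x : ℝ} (hx : x ∈ Icc 0 L) : extend f x = f ⟨x, hx⟩ :=
  IccExtend_of_mem _ _ hx

lemma CI.ext_extend {f g : CI L} (h : ∀ x ∈ Icc 0 L, extend f x = extend g x) : f = g := by
  ext x
  have := h x x.2
  rwa [extend_apply, extend_apply] at this

@[simp] lemma extend_zero (x : ℝ) : extend (0 : CI L) x = 0 := rfl
@[simp] lemma extend_one (x : ℝ) : extend (1 : CI L) x = 1 := rfl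
@[simp] lemma extend_add (f g : CI L) (x : ℝ) : extend (f + g) x = extend f x + extend g x := rfl
@[simp] lemma extend_sub (f g : CI L) (x : ℝ) : extend (f - g) x = extend f x - extend g x := rfl
@[simp] lemma extend_neg (f : CI L) (x : ℝ) : extend (-f) x = - extend f x := rfl
@[simp] lemma extend_mul (f g : CI L) (x : ℝ) : extend (f * g) x = extend f x * extend g x := rfl
@[simp] lemma extend_smul (c : ℝ) (f : CI L) (x : ℝ) : extend (c • f) x = c * extend f x := rfl
@[simp] lemma extend_const (c x : ℝ) : extend (ContinuousMap.const _ c : CI L) x = c := rfl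

lemma abs_extend_le (f : CI L) (x : ℝ) : |extend f x| ≤ ‖f‖ := f.norm_coe_le_norm _

/-- The restriction to `[0, L]` of a function that is continuous there. -/
def restr {f : ℝ → ℝ} (hf : ContinuousOn f (Icc 0 L)) : CI L :=
  ⟨(Icc 0 L).domRestrict f, hf.domRestrict⟩

lemma extend_restr {f : ℝ → ℝ} (hf : ContinuousOn f (Icc 0 L)) {x : ℝ} (hx : x ∈ Icc 0 L) :
    extend (restr hf) x = f x := extend_of_mem _ hx

lemma zero_mem_I : (0 : ℝ) ∈ Icc 0 L := ⟨le_rfl, hL.out.le⟩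
lemma end_mem_I : L ∈ Icc 0 L := ⟨hL.out.le, le_rfl⟩

/-- Evaluation at a point as a continuous linear functional. -/
def evalCI (x : ℝ) : CI L →L[ℝ] ℝ := ContinuousMap.evalCLM ℝ (projIcc 0 L hL.out.le x)

@[simp] lemma evalCI_apply (x : ℝ) (f : CI L) : evalCI x f = extend f x := rfl

lemma memLp_extend (f : CI L) : MemLp (extend f) 2 (vol L) :=
  memLp_of_continuousOn (continuous_extend f).continuousOn 2

/-- The embedding of `C[0, L]` into `L²(0, L)`. -/
def toL2 : CI L →L[ℝ] L2 L :=
  LinearMap.mkContinuous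
    { toFun := fun f => (memLp_extend f).toLp (extend f)
      map_add' := fun f g => rfl
      map_smul' := fun c f => rfl }
    ((measureUnivNNReal (vol L) : ℝ) ^ (2 : ℝ≥0∞).toReal⁻¹) (fun f => by
      refine Lp.norm_le_of_ae_bound (norm_nonneg f) ?_
      filter_upwards [(memLp_extend f).coeFn_toLp] with x hx
      show ‖(memLp_extend f).toLp (extend f) x‖ ≤ _
      rw [hx]
      exact abs_extend_le f x)

lemma coeFn_toL2 (f : CI L) : toL2 f =ᵐ[vol L] extend f := (memLp_extend f).coeFn_toLp

lemma CI.eq_of_ae_eq {f g : CI L} (h : extend f =ᵐ[vol L] extend g) : f = g := by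
  refine CI.ext_extend ?_
  have h' : extend f =ᵐ[volume.restrict (Icc 0 L)] extend g := by
    rwa [← restrict_Ioo_eq_restrict_Icc]
  refine Measure.eqOn_Icc_of_ae_eq volume hL.out.ne h' (continuous_extend f).continuousOn
    (continuous_extend g).continuousOn

lemma toL2_injective : Function.Injective (toL2 : CI L → L2 L) := fun f g h =>
  CI.eq_of_ae_eq ((coeFn_toL2 f).symm.trans ((h ▸ coeFn_toL2 g : toL2 f =ᵐ[vol L] extend g)))

lemma intervalIntegrable_L2 (g : L2 L) {x y : ℝ} (hx : x ∈ Icc 0 L) (hy : y ∈ Icc 0 L) :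
    IntervalIntegrable g volume x y := by
  have : IntervalIntegrable g volume 0 L := by
    rw [intervalIntegrable_iff_integrableOn_Ioo_of_le hL.out.le]
    exact (Lp.memLp g).integrable (by norm_num)
  refine this.mono_set ?_
  rw [uIcc_of_le hL.out.le]
  exact (convex_Icc (0:ℝ) L).ordConnected.uIcc_subset hx hy

lemma continuousOn_prim (g : L2 L) : ContinuousOn (fun x => ∫ t in (0 : ℝ)..x, g t) (Icc 0 L) := by
  have h : IntegrableOn g (uIcc 0 L) volume := by
    rw [uIcc_of_le hL.out.le]
    exact (intervalIntegrable_iff_integrableOn_Icc_of_le hL.out.le).1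
      (intervalIntegrable_L2 g zero_mem_I end_mem_I)
  have := intervalIntegral.continuousOn_primitive_interval h
  rwa [uIcc_of_le hL.out.le] at this

/-- The primitive `x ↦ ∫₀ˣ g` of `g ∈ L²(0, L)`. -/
def prim : L2 L →L[ℝ] CI L :=
  LinearMap.mkContinuous
    { toFun := fun g => restr (continuousOn_prim g)
      map_add' := fun f g => by
        refine CI.ext_extend fun x hx => ?_
        rw [extend_add, extend_restr _ hx, extend_restr _ hx, extend_restr _ hx,
          ← intervalIntegral.integral_add (intervalIntegrable_L2 _ zero_mem_I hx)
          (intervalIntegrable_L2 _ zero_mem_I hx)]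
        exact intervalIntegral_congr_vol (Lp.coeFn_add f g) zero_mem_I hx
      map_smul' := fun c f => by
        refine CI.ext_extend fun x hx => ?_
        rw [RingHom.id_apply, extend_smul, extend_restr _ hx, extend_restr _ hx,
          ← intervalIntegral.integral_const_mul]
        exact intervalIntegral_congr_vol (Lp.coeFn_smul c f) zero_mem_I hx }
    ((vol L univ ^ (1 / (1 : ℝ≥0∞).toReal - 1 / (2 : ℝ≥0∞).toReal)).toReal) (fun g => by
      refine (ContinuousMap.norm_le _ (by positivity)).2 fun x => ?_
      rw [mul_comm]
      refine le_trans ?_ (integral_norm_L2_le g)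
      show ‖∫ t in (0 : ℝ)..x, g t‖ ≤ _
      rw [intervalIntegral.integral_of_le x.2.1]
      refine (norm_integral_le_integral_norm _).trans ?_
      refine le_trans ?_ (integral_Ioc_eq_integral_Ioo (x := 0) (y := L)).le
      refine setIntegral_mono_set ?_ (Filter.Eventually.of_forall fun _ => norm_nonneg _)
        (Filter.Eventually.of_forall (Ioc_subset_Ioc_right x.2.2))
      rw [IntegrableOn, ← restrict_Ioo_eq_restrict_Ioc]
      exact ((Lp.memLp g).integrable (by norm_num)).norm)

lemma extend_prim (g : L2 L) {x : ℝ} (hx : x ∈ Icc 0 L) :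
    extend (prim g) x = ∫ t in (0 : ℝ)..x, g t := extend_restr (continuousOn_prim g) hx

@[simp] lemma extend_prim_zero (g : L2 L) : extend (prim g) 0 = 0 := by
  rw [extend_prim g zero_mem_I, intervalIntegral.integral_same]

/-- By Lebesgue differentiation the primitive has derivative `g` almost everywhere, while a
vanishing primitive has derivative `0` inside the interval. -/
lemma prim_injective : Function.Injective (prim : L2 L → CI L) := by
  refine (injective_iff_map_eq_zero _).2 fun g hg => ?_
  refine Lp.ext (Filter.EventuallyEq.trans ?_ (Lp.coeFn_zero _ _ _).symm)
  have hgi := intervalIntegrable_L2 g zero_mem_I (end_mem_I (L := L))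
  rw [Filter.EventuallyEq, ae_restrict_iff' measurableSet_Ioo]
  filter_upwards [hgi.ae_hasDerivAt_integral] with x hx hxL
  have h1 := hx (by rw [uIcc_of_le hL.out.le]; exact Ioo_subset_Icc_self hxL) 0 (by simp)
  have h2 : HasDerivAt (fun x => ∫ t in (0 : ℝ)..x, g t) 0 x := by
    refine (hasDerivAt_const x (0 : ℝ)).congr_of_eventuallyEq ?_
    filter_upwards [Ioo_mem_nhds hxL.1 hxL.2] with y hy
    rw [← extend_prim g (Ioo_subset_Icc_self hy), hg, extend_zero]
  exact h1.unique h2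

/-- The primitive of a continuous function. -/
def primC : CI L →L[ℝ] CI L := prim ∘L toL2

lemma primC_apply (f : CI L) : primC f = prim (toL2 f) := rfl

lemma extend_primC (f : CI L) {x : ℝ} (hx : x ∈ Icc 0 L) :
    extend (primC f) x = ∫ t in (0 : ℝ)..x, extend f t := by
  rw [primC_apply, extend_prim _ hx]
  exact intervalIntegral_congr_vol (coeFn_toL2 f) zero_mem_I hx

@[simp] lemma extend_primC_zero (g : CI L) : extend (primC g) 0 = 0 := extend_prim_zero _

/-- `f'` is the derivative of `f` on `[0, L]`. -/
def HasDerivI (f f' : CI L) : Prop :=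
  ∀ x ∈ Icc 0 L, HasDerivWithinAt (extend f) (extend f' x) (Icc 0 L) x

lemma hasDerivI_const (c : ℝ) : HasDerivI (ContinuousMap.const _ c : CI L) 0 :=
  fun x _ => hasDerivWithinAt_const x _ c

lemma hasDerivI_primC (f : CI L) : HasDerivI (primC f) f := by
  intro x hx
  have h : HasDerivAt (fun y => ∫ t in (0 : ℝ)..y, extend f t) (extend f x) x :=
    intervalIntegral.integral_hasDerivAt_right ((continuous_extend f).intervalIntegrable _ _)
      ((continuous_extend f).stronglyMeasurableAtFilter volume _) (continuous_extend f).continuousAt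
  exact h.hasDerivWithinAt.congr (fun y hy => extend_primC f hy) (extend_primC f hx)

lemma HasDerivI.add {f f' g g' : CI L} (hf : HasDerivI f f') (hg : HasDerivI g g') :
    HasDerivI (f + g) (f' + g') := fun x hx => (hf x hx).add (hg x hx)

lemma HasDerivI.sub {f f' g g' : CI L} (hf : HasDerivI f f') (hg : HasDerivI g g') :
    HasDerivI (f - g) (f' - g') := fun x hx => (hf x hx).sub (hg x hx)

lemma HasDerivI.mul {f f' g g' : CI L} (hf : HasDerivI f f') (hg : HasDerivI g g') :
    HasDerivI (f * g) (f' * g + f * g') := fun x hx => (hf x hx).mul (hg x hx)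

lemma HasDerivI.smul {f f' : CI L} (c : ℝ) (hf : HasDerivI f f') :
    HasDerivI (c • f) (c • f') := fun x hx => (hf x hx).const_smul c

/-- The fundamental theorem of calculus, used throughout to turn differential equations into
integral equations. -/
lemma HasDerivI.eq_add_primC {f f' : CI L} (h : HasDerivI f f') :
    f = ContinuousMap.const _ (extend f 0) + primC f' := by
  refine CI.ext_extend fun x hx => ?_
  rw [extend_add, extend_const, extend_primC f' hx]
  rw [intervalIntegral.integral_eq_sub_of_hasDerivAt_of_le hx.1
    (continuous_extend f).continuousOn (fun y hy => ?_)
    ((continuous_extend f').intervalIntegrable _ _)]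
  · ring
  · have hy' : y ∈ Ioo 0 L := ⟨hy.1, hy.2.trans_le hx.2⟩
    exact (h y (Ioo_subset_Icc_self hy')).hasDerivAt (Icc_mem_nhds hy'.1 hy'.2)

lemma hasDerivI_const_add_primC (c : ℝ) (f : CI L) :
    HasDerivI (ContinuousMap.const _ c + primC f) f := by
  simpa using (hasDerivI_const c).add (hasDerivI_primC f)

lemma HasDerivI.unique {f f' f'' : CI L} (h : HasDerivI f f') (h' : HasDerivI f f'') :
    f' = f'' :=
  CI.ext_extend fun x hx => (uniqueDiffOn_Icc hL.out x hx).eq_deriv _ (h x hx) (h' x hx)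

/-- Integrating a monomial bound gains one power of `x` and a factor `1 / (n + 1)`; two such gains
per Volterra iterate build up `(2 n)!`. -/
lemma abs_extend_primC_le {f : CI L} {B : ℝ} {n : ℕ}
    (h : ∀ x ∈ Icc 0 L, |extend f x| ≤ B * x ^ n) :
    ∀ x ∈ Icc 0 L, |extend (primC f) x| ≤ B / (n + 1) * x ^ (n + 1) := by
  intro x hx
  rw [extend_primC f hx]
  have hi : IntervalIntegrable (fun t : ℝ => B * t ^ n) volume 0 x :=
    Continuous.intervalIntegrable (by fun_prop) _ _
  refine (intervalIntegral.norm_integral_le_of_norm_le hx.1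
    (Filter.Eventually.of_forall fun t ht => by
      rw [Real.norm_eq_abs]; exact h t ⟨ht.1.le, ht.2.trans hx.2⟩) hi).trans ?_
  rw [intervalIntegral.integral_const_mul, integral_pow]
  apply le_of_eq
  simp
  ring

/-- The Volterra operator `f ↦ ∫₀ˣ ∫₀ˢ q f`. -/
def volterra (q : CI L) : CI L →L[ℝ] CI L :=
  primC ∘L primC ∘L ContinuousLinearMap.mul ℝ (CI L) q

lemma volterra_apply (q f : CI L) : volterra q f = primC (primC (q * f)) := rfl

lemma abs_extend_volterra_pow_le (q f : CI L) (n : ℕ) :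
    ∀ x ∈ Icc 0 L, |extend ((volterra q ^ n) f) x| ≤
      (‖q‖ ^ n * ‖f‖ / (2 * n).factorial) * x ^ (2 * n) := by
  induction n with
  | zero => intro x _; simpa using abs_extend_le f x
  | succ n ih =>
    intro x hx
    rw [pow_succ', mul_apply_eq_comp, volterra_apply]
    have h1 : ∀ x ∈ Icc 0 L, |extend (q * (volterra q ^ n) f) x| ≤
        (‖q‖ * (‖q‖ ^ n * ‖f‖ / (2 * n).factorial)) * x ^ (2 * n) := by
      intro x hx
      rw [extend_mul, abs_mul, mul_assoc]
      exact mul_le_mul (abs_extend_le q x) (ih x hx) (abs_nonneg _) (norm_nonneg _)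
    refine (abs_extend_primC_le (abs_extend_primC_le h1) x hx).trans (le_of_eq ?_)
    have h2 : ((2 * (n + 1)).factorial : ℝ) = (2 * n + 2) * ((2 * n + 1) * (2 * n).factorial) := by
      rw [show 2 * (n + 1) = 2 * n + 1 + 1 by ring, Nat.factorial_succ, Nat.factorial_succ]
      push_cast; ring
    rw [h2]
    have h3 : (2 * (n : ℝ) + 1) ≠ 0 := by positivity
    have h4 : (2 * (n : ℝ) + 2) ≠ 0 := by positivity
    have h5 : ((2 * n).factorial : ℝ) ≠ 0 := by positivity
    push_cast
    have h6 : (2 * (n : ℝ) + 1 + 1) ≠ 0 := by positivity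
    field_simp
    ring

lemma exists_norm_volterra_pow_lt_one (q : CI L) : ∃ n, ‖volterra q ^ n‖ < 1 := by
  obtain ⟨n, hn⟩ := ((FloorSemiring.tendsto_pow_div_factorial_atTop (‖q‖ * L ^ 2)).eventually
    (gt_mem_nhds zero_lt_one)).exists
  refine ⟨n, lt_of_le_of_lt ?_ hn⟩
  have hL0 : 0 ≤ L := hL.out.le
  refine ContinuousLinearMap.opNorm_le_bound _ (by positivity) fun f => ?_
  refine (ContinuousMap.norm_le _ (by positivity)).2 fun x => ?_
  rw [← extend_apply]
  refine (abs_extend_volterra_pow_le q f n x x.2).trans ?_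
  -- Weakening `(2 n)!` to `n!` leaves the general term of an exponential series, which tends to
  -- zero.
  calc (‖q‖ ^ n * ‖f‖ / (2 * n).factorial) * (x : ℝ) ^ (2 * n)
      ≤ (‖q‖ ^ n * ‖f‖ / n.factorial) * L ^ (2 * n) := by
        gcongr
        · exact pow_nonneg x.2.1 _
        · omega
        · exact x.2.1
        · exact x.2.2
    _ = (‖q‖ * L ^ 2) ^ n / n.factorial * ‖f‖ := by rw [mul_pow, ← pow_mul]; ring

/-- The operator `1 - volterra q ^ n` is invertible by the Neumann series and is the product of `1 -
volterra q` with a commuting geometric sum, so each factor is invertible. -/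
lemma isUnit_one_sub_volterra (q : CI L) : IsUnit (1 - volterra q) := by
  obtain ⟨n, hn⟩ := exists_norm_volterra_pow_lt_one q
  have h := isUnit_one_sub_of_norm_lt_one (x := volterra q ^ n) hn
  rw [← mul_neg_geom_sum] at h
  have hc : Commute (1 - volterra q) (∑ i ∈ Finset.range n, volterra q ^ i) := by
    rw [Commute, SemiconjBy, mul_neg_geom_sum, geom_sum_mul_neg]
  exact (hc.isUnit_mul_iff.1 h).1

/-- The isomorphism `f ↦ f - ∫₀ˣ ∫₀ˢ q f` of `C[0, L]`. -/
def volterraEquiv (q : CI L) : CI L ≃L[ℝ] CI L :=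
  ContinuousLinearEquiv.unitsEquiv ℝ (CI L) (isUnit_one_sub_volterra q).unit

lemma volterraEquiv_apply (q f : CI L) : volterraEquiv q f = f - primC (primC (q * f)) := rfl

/-- For `g = idI` this says that the inverse image is the solution `φ` of `φ_xx = q φ` with `φ(0) =
0`, `φ_x(0) = 1`. -/
lemma volterraEquiv_symm_eq (q g : CI L) :
    (volterraEquiv q).symm g = g + primC (primC (q * (volterraEquiv q).symm g)) := by
  have := (volterraEquiv q).apply_symm_apply g
  rw [volterraEquiv_apply, sub_eq_iff_eq_add] at this
  exact this

/-- The identity function on `[0, L]`. -/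
def idI : CI L := restr (f := fun x => x) continuousOn_id

lemma extend_idI {x : ℝ} (hx : x ∈ Icc 0 L) : extend (idI : CI L) x = x := extend_restr _ hx

lemma hasDerivI_idI : HasDerivI (idI : CI L) 1 := fun x hx =>
  (hasDerivWithinAt_id x _).congr (fun _ hy => extend_idI hy) (extend_idI hx)

end CI

/-! ### Continuous representatives and completeness of Sobolev spaces -/

section Sobolev

variable {m : ℕ} {L : ℝ}

/-- The `k`-th weak derivative as a continuous linear map. -/
def wdL (k : Fin (m + 1)) : Sobolev m L →L[ℝ] L2 L :=
  (PiLp.proj 2 (fun _ : Fin (m + 1) => L2 L) k : _ →L[ℝ] _) ∘L (Sobolev m L).subtypeL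

@[simp] lemma wdL_apply (k : Fin (m + 1)) (u : Sobolev m L) : wdL k u = wd u k := rfl

lemma Sobolev.ext_wd {u v : Sobolev m L} (h : ∀ k, wd u k = wd v k) : u = v :=
  Subtype.ext (PiLp.ext h)

@[simp] lemma wd_add (u v : Sobolev m L) (k : Fin (m + 1)) : wd (u + v) k = wd u k + wd v k := rfl
@[simp] lemma wd_sub (u v : Sobolev m L) (k : Fin (m + 1)) : wd (u - v) k = wd u k - wd v k := rfl

/-- The pairing of elements of `L²(0, L)` with a test function. -/
def testPairing {φ : ℝ → ℝ} (hφ : IsTest L φ) : L2 L →L[ℝ] ℝ :=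
  innerSL ℝ ((memLp_of_continuousOn hφ.smooth.continuous.continuousOn 2).toLp φ : L2 L)

lemma testPairing_apply {φ : ℝ → ℝ} (hφ : IsTest L φ) (f : L2 L) :
    testPairing hφ f = ∫ x, f x * φ x ∂(vol L) := by
  rw [testPairing, innerSL_apply_apply, L2.inner_def]
  refine integral_congr_ae ?_
  filter_upwards [(memLp_of_continuousOn (L := L) hφ.smooth.continuous.continuousOn 2).coeFn_toLp]
    with x hx
  rw [hx]
  simp

/-- Each weak derivative condition equates two continuous functionals of the tuple. The resulting
completeness is needed for the closed graph, open mapping and implicit function theorems. -/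
lemma isClosed_sobolev : IsClosed (Sobolev m L : Set (PiLp 2 fun _ : Fin (m + 1) => L2 L)) := by
  have : (Sobolev m L : Set (PiLp 2 fun _ : Fin (m + 1) => L2 L)) =
      ⋂ (k : Fin m), ⋂ (φ : ℝ → ℝ), ⋂ (hφ : IsTest L φ),
        {u | testPairing hφ.deriv (u k.castSucc) = - testPairing hφ (u k.succ)} := by
    ext u
    simp only [mem_iInter, mem_ofPred_eq, testPairing_apply]
    rfl
  rw [this]
  refine isClosed_iInter fun k => isClosed_iInter fun φ => isClosed_iInter fun hφ =>
    isClosed_eq ?_ ?_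
  · exact (testPairing hφ.deriv).continuous.comp (PiLp.continuous_apply 2 _ _)
  · exact ((testPairing hφ).continuous.comp (PiLp.continuous_apply 2 _ _)).neg

instance : CompleteSpace (Sobolev m L) := isClosed_sobolev.completeSpace_coe

variable [hL : Fact (0 < L)]

lemma exists_continuous_rep (u : Sobolev m L) (k : Fin m) :
    ∃ c : ℝ, toL2 (ContinuousMap.const _ c + prim (wd u k.succ)) = wd u k.castSucc := by
  obtain ⟨F, hF, h0, h1⟩ := exists_ac_rep hL.out (Lp.memLp (wd u k.castSucc))
    (Lp.memLp (wd u k.succ)) (u.2 k)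
  refine ⟨F 0, Lp.ext ?_⟩
  filter_upwards [coeFn_toL2 (ContinuousMap.const _ (F 0) + prim (wd u k.succ)), h0,
    ae_restrict_mem measurableSet_Ioo] with x hx hx0 hxI
  have hx' := Ioo_subset_Icc_self hxI
  rw [hx, hx0, extend_add, extend_const, extend_prim _ hx',
    ← intervalIntegral_congr_vol h1 zero_mem_I hx',
    AbsolutelyContinuousOnInterval.integral_deriv_eq_sub]
  · ring
  · refine hF.mono ?_
    rw [uIcc_of_le hx'.1, uIcc_of_le hL.out.le]
    exact Icc_subset_Icc_right hx'.2

lemma exists_toL2_eq_wd (u : Sobolev m L) (k : Fin m) : ∃ f : CI L, toL2 f = wd u k.castSucc := by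
  obtain ⟨c, hc⟩ := exists_continuous_rep u k
  exact ⟨_, hc⟩

/-- The continuous representative of a derivative of order less than `m`, as a linear map. -/
def repLinear (k : Fin m) : Sobolev m L →ₗ[ℝ] CI L where
  toFun u := (exists_toL2_eq_wd u k).choose
  map_add' u v := toL2_injective <| by
    rw [map_add, (exists_toL2_eq_wd _ k).choose_spec, (exists_toL2_eq_wd _ k).choose_spec,
      (exists_toL2_eq_wd _ k).choose_spec]
    rfl
  map_smul' c u := toL2_injective <| by
    rw [map_smul, (exists_toL2_eq_wd _ k).choose_spec, (exists_toL2_eq_wd _ k).choose_spec]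
    rfl

lemma toL2_repLinear (k : Fin m) (u : Sobolev m L) : toL2 (repLinear k u) = wd u k.castSucc :=
  (exists_toL2_eq_wd u k).choose_spec

/-- Injectivity of `toL2` makes the graph the equality set of two continuous maps. The closed graph
theorem then yields the Sobolev embedding into `C[0, L]` without an explicit estimate. -/
lemma isClosed_graph_repLinear (k : Fin m) :
    IsClosed ((repLinear (L := L) k).graph : Set (Sobolev m L × CI L)) := by
  have : ((repLinear (L := L) k).graph : Set (Sobolev m L × CI L)) =
      {p | toL2 p.2 = wdL k.castSucc p.1} := by
    ext p
    rw [SetLike.mem_coe, LinearMap.mem_graph_iff, mem_ofPred_eq, wdL_apply, ← toL2_repLinear,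
      toL2_injective.eq_iff]
  rw [this]
  exact isClosed_eq (toL2.continuous.comp continuous_snd) ((wdL _).continuous.comp continuous_fst)

/-- The continuous representative of the `k`-th derivative of `u ∈ Hᵐ(0, L)`, `k < m`. -/
def rep (k : Fin m) : Sobolev m L →L[ℝ] CI L :=
  ContinuousLinearMap.ofIsClosedGraph (isClosed_graph_repLinear k)

lemma toL2_rep (k : Fin m) (u : Sobolev m L) : toL2 (rep k u) = wd u k.castSucc :=
  toL2_repLinear k u

lemma rep_eq_of_toL2_eq {k : Fin m} {u : Sobolev m L} {f : CI L} (h : toL2 f = wd u k.castSucc) :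
    rep k u = f :=
  toL2_injective ((toL2_rep k u).trans h.symm)

lemma coeFn_wd_castSucc (k : Fin m) (u : Sobolev m L) :
    wd u k.castSucc =ᵐ[vol L] extend (rep k u) := by
  rw [← toL2_rep]
  exact coeFn_toL2 _

lemma rep_eq_const_add_prim (k : Fin m) (u : Sobolev m L) :
    rep k u = ContinuousMap.const _ (extend (rep k u) 0) + prim (wd u k.succ) := by
  obtain ⟨c, hc⟩ := exists_continuous_rep u k
  have h := rep_eq_of_toL2_eq hc
  have h0 : extend (rep k u) 0 = c := by rw [h]; simp
  rw [h0, h]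

/-- Two continuous functions that agree almost everywhere on the interval agree at its endpoints, so
a boundary value does not depend on the representative. -/
lemma hasBoundaryValue_iff (k : Fin m) (u : Sobolev m L) {a c : ℝ} (ha : a ∈ Icc 0 L) :
    HasBoundaryValue L (wd u k.castSucc) a c ↔ extend (rep k u) a = c := by
  constructor
  · rintro ⟨F, hF, h1, rfl⟩
    have h2 : rep k u = restr hF := by
      refine CI.eq_of_ae_eq ?_
      filter_upwards [coeFn_wd_castSucc k u, h1, ae_restrict_mem measurableSet_Ioo] with x k1 k2 hx
      rw [← k1, k2, extend_restr _ (Ioo_subset_Icc_self hx)]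
    rw [h2, extend_restr _ ha]
  · intro h
    exact ⟨extend (rep k u), (continuous_extend _).continuousOn, coeFn_wd_castSucc k u, h⟩

lemma hasDerivI_rep (k : Fin m) (u : Sobolev (m + 1) L) :
    HasDerivI (rep k.castSucc u) (rep k.succ u) := by
  have h := rep_eq_const_add_prim k.castSucc u
  rw [Fin.succ_castSucc, ← toL2_rep] at h
  rw [h]
  exact hasDerivI_const_add_primC _ _

lemma hasWeakDeriv_prim (c : ℝ) (g : L2 L) :
    HasWeakDeriv L (toL2 (ContinuousMap.const _ c + prim g)) g := by
  have hg := intervalIntegrable_L2 g zero_mem_I (end_mem_I (L := L))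
  have hac : AbsolutelyContinuousOnInterval ((fun _ => c) + fun x => ∫ t in (0 : ℝ)..x, g t) 0 L :=
    ((contDiff_const (n := 1)).contDiffOn.absolutelyContinuousOnInterval).add
      (hg.absolutelyContinuousOnInterval_intervalIntegral (by simp))
  have hd : deriv ((fun _ => c) + fun x => ∫ t in (0 : ℝ)..x, g t) =ᵐ[vol L] g := by
    rw [Filter.EventuallyEq, ae_restrict_iff' measurableSet_Ioo]
    filter_upwards [hg.ae_hasDerivAt_integral] with x hx hxL
    have := (hx (by rw [uIcc_of_le hL.out.le]; exact Ioo_subset_Icc_self hxL) 0 (by simp))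
    simpa using ((hasDerivAt_const x c).add this).deriv
  refine (hasWeakDeriv_of_ac hL.out hac hd).congr ?_ (ae_eq_refl _)
  filter_upwards [coeFn_toL2 (ContinuousMap.const _ c + prim g), ae_restrict_mem measurableSet_Ioo]
    with x hx hxI
  rw [hx, extend_add, extend_const, extend_prim _ (Ioo_subset_Icc_self hxI)]
  rfl

/-- The antiderivative with value `a` at `0` of an element of `Hᵐ(0, L)`. -/
def consSobolev (a : ℝ) (p : Sobolev m L) : Sobolev (m + 1) L :=
  ⟨WithLp.toLp 2 (Fin.cons (toL2 (ContinuousMap.const _ a + prim (wd p 0))) (fun k => wd p k)), by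
    intro k
    refine Fin.cases ?_ (fun j => ?_) k
    · exact hasWeakDeriv_prim a (wd p 0)
    · exact p.2 j⟩

lemma wd_consSobolev_zero (a : ℝ) (p : Sobolev m L) :
    wd (consSobolev a p) 0 = toL2 (ContinuousMap.const _ a + prim (wd p 0)) := rfl

omit hL in
/-- The derivative, as a map `Hᵐ⁺¹(0, L) → Hᵐ(0, L)`. -/
def tailSobolev (u : Sobolev (m + 1) L) : Sobolev m L :=
  ⟨WithLp.toLp 2 fun k => wd u k.succ, fun k => u.2 k.succ⟩

omit hL in
/-- The inclusion `Hᵐ⁺¹(0, L) → Hᵐ(0, L)`. -/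
def initSobolev (u : Sobolev (m + 1) L) : Sobolev m L :=
  ⟨WithLp.toLp 2 fun k => wd u k.castSucc, fun k => u.2 k.castSucc⟩

omit hL in
/-- Elements of `L²(0, L)` as elements of `H⁰(0, L)`. -/
def ofL2 (g : L2 L) : Sobolev 0 L := ⟨WithLp.toLp 2 fun _ => g, fun k => k.elim0⟩

omit hL in
lemma wd_ofL2 (g : L2 L) (k : Fin 1) : wd (ofL2 g) k = g := rfl

/-- Weak derivatives are unique: equal representatives have equal primitives of the next
derivatives, and `prim` is injective. Identities in Sobolev spaces thus need checking at order zero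
only. -/
lemma Sobolev.ext_wd_zero {u v : Sobolev m L} (h : wd u 0 = wd v 0) : u = v := by
  refine Sobolev.ext_wd fun k => ?_
  induction k using Fin.induction with
  | zero => exact h
  | succ k ih =>
    have h1 : rep k u = rep k v := rep_eq_of_toL2_eq ((toL2_rep k v).trans ih.symm)
    have h2 := rep_eq_const_add_prim k u
    rw [h1, rep_eq_const_add_prim k v] at h2
    simp only [extend_add, extend_const, extend_prim_zero, add_zero] at h2
    exact (prim_injective (add_left_cancel h2)).symm

lemma exists_sobolev_two {f f' f'' : CI L} (h : HasDerivI f f') (h' : HasDerivI f' f'') :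
    ∃ p : Sobolev 2 L, wd p 0 = toL2 f ∧ wd p 1 = toL2 f' ∧ wd p 2 = toL2 f'' := by
  have e1 : toL2 (ContinuousMap.const _ (extend f' 0) + prim (toL2 f'')) = toL2 f' := by
    rw [h'.eq_add_primC]; simp [primC_apply]
  refine ⟨consSobolev (extend f 0) (consSobolev (extend f' 0) (ofL2 (toL2 f''))), ?_, e1, rfl⟩
  rw [wd_consSobolev_zero, wd_consSobolev_zero, wd_ofL2, e1, ← primC_apply, ← h.eq_add_primC]

end Sobolev

/-! ### The chemical potential, the steady state operator and its derivative -/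

section ChemPot

variable {L : ℝ} [hL : Fact (0 < L)]

/-- The restriction to `[0, L]` of a function that is analytic on `[0, ∞)`. -/
def analyticRestr {f : ℝ → ℝ} (hf : AnalyticOnNhd ℝ f (Ici 0)) : CI L :=
  restr (hf.continuousOn.mono Icc_subset_Ici_self)

lemma hasDerivI_analyticRestr {f : ℝ → ℝ} (hf : AnalyticOnNhd ℝ f (Ici 0)) :
    HasDerivI (analyticRestr hf : CI L) (analyticRestr hf.deriv) := by
  intro x hx
  rw [analyticRestr, analyticRestr, extend_restr _ hx]
  exact ((hf x hx.1).differentiableAt.hasDerivAt.hasDerivWithinAt (s := Icc 0 L)).congr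
    (fun y hy => extend_restr _ hy) (extend_restr _ hx)

/-- The total concentration `u + c₀`. -/
def shift (c₀ : ℝ) (u : Sobolev 4 L) : CI L := rep 0 u + ContinuousMap.const _ c₀

lemma hasDerivI_shift (c₀ : ℝ) (u : Sobolev 4 L) : HasDerivI (shift c₀ u) (rep 1 u) := by
  simpa [shift] using (hasDerivI_rep 0 u).add (hasDerivI_const c₀)

lemma HasDerivI.of_eq {f f' g : CI L} (h : HasDerivI f g) (e : g = f') : HasDerivI f f' := e ▸ h

variable {ζ : ℝ → ℝ} (hζ : AnalyticOnNhd ℝ ζ (Ici 0)) (c₀ : ℝ) (u : Sobolev 4 L)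

/-- The reaction term `(u + c₀)³ - (u + c₀) + ζ`. -/
def reaction : CI L :=
  shift c₀ u * shift c₀ u * shift c₀ u - shift c₀ u + analyticRestr hζ

/-- The potential `3 (u + c₀)² - 1` of the linearized operator. -/
def potential : CI L := (3 : ℝ) • (shift c₀ u * shift c₀ u) - 1

/-- The derivative of the potential. -/
def potentialD : CI L := (6 : ℝ) • (shift c₀ u * rep 1 u)

/-- The second derivative of the potential. -/
def potentialDD : CI L := (6 : ℝ) • (rep 1 u * rep 1 u + shift c₀ u * rep 2 u)

lemma hasDerivI_potential : HasDerivI (potential c₀ u) (potentialD c₀ u) := by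
  have h := hasDerivI_shift c₀ u
  refine (((h.mul h).smul 3).sub (hasDerivI_const (1 : ℝ))).of_eq ?_
  ext x
  simp [potentialD]
  ring

lemma hasDerivI_potentialD : HasDerivI (potentialD c₀ u) (potentialDD c₀ u) :=
  ((hasDerivI_shift c₀ u).mul (hasDerivI_rep 1 u)).smul 6

lemma hasDerivI_reaction : HasDerivI (reaction hζ c₀ u)
    (potential c₀ u * rep 1 u + analyticRestr hζ.deriv) := by
  have h := hasDerivI_shift c₀ u
  refine ((((h.mul h).mul h).sub h).add (hasDerivI_analyticRestr hζ)).of_eq ?_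
  ext x
  simp [potential]
  ring

lemma hasDerivI_reaction' : HasDerivI (potential c₀ u * rep 1 u + analyticRestr hζ.deriv)
    (potentialD c₀ u * rep 1 u + potential c₀ u * rep 2 u + analyticRestr hζ.deriv.deriv) :=
  ((hasDerivI_potential c₀ u).mul (hasDerivI_rep 1 u)).add (hasDerivI_analyticRestr hζ.deriv)

lemma wd_chemPot_zero : wd (chemPot hζ c₀ u) 0 = - wd u 2 + toL2 (reaction hζ c₀ u) := by
  have h : IsChemPot ζ c₀ u (chemPot hζ c₀ u) := (exists_chemPot hζ c₀ u).choose_spec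
  refine Lp.ext (h.trans ?_)
  filter_upwards [Lp.coeFn_add (- wd u 2) (toL2 (reaction hζ c₀ u)), Lp.coeFn_neg (wd u 2),
    coeFn_toL2 (reaction hζ c₀ u), coeFn_wd_castSucc 0 u, ae_restrict_mem measurableSet_Ioo]
    with x h1 h2 h3 h4 hx
  have h4' : wd u 0 x = extend (rep 0 u) x := h4
  rw [h1, Pi.add_apply, h2, h3, h4', Pi.neg_apply]
  simp only [reaction, shift, extend_add, extend_sub, extend_mul, extend_const, analyticRestr]
  rw [extend_restr _ (Ioo_subset_Icc_self hx)]
  ring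

/-- `chemPot` is obtained by choice from a condition at order zero alone. Uniqueness of weak
derivatives identifies all its components, whence the explicit formulas of `wd_chemPot`. -/
lemma chemPot_eq {p : Sobolev 2 L} (h : wd p 0 = toL2 (reaction hζ c₀ u)) :
    chemPot hζ c₀ u = - tailSobolev (tailSobolev u) + p :=
  Sobolev.ext_wd_zero <| by
    rw [wd_chemPot_zero, wd_add, h]
    rfl

lemma wd_chemPot : wd (chemPot hζ c₀ u) 1 =
      - wd u 3 + toL2 (potential c₀ u * rep 1 u + analyticRestr hζ.deriv) ∧
    wd (chemPot hζ c₀ u) 2 = - wd u 4 + toL2 (potentialD c₀ u * rep 1 u +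
      potential c₀ u * rep 2 u + analyticRestr hζ.deriv.deriv) := by
  obtain ⟨p, h0, h1, h2⟩ := exists_sobolev_two (hasDerivI_reaction hζ c₀ u)
    (hasDerivI_reaction' hζ c₀ u)
  rw [chemPot_eq hζ c₀ u h0, wd_add, wd_add, h1, h2]
  exact ⟨rfl, rfl⟩

lemma rep_chemPot_zero : rep 0 (chemPot hζ c₀ u) = - rep 2 u + reaction hζ c₀ u :=
  rep_eq_of_toL2_eq <| by
    rw [map_add, map_neg, toL2_rep]
    exact (wd_chemPot_zero hζ c₀ u).symm

lemma rep_chemPot_one : rep 1 (chemPot hζ c₀ u) =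
    - rep 3 u + (potential c₀ u * rep 1 u + analyticRestr hζ.deriv) :=
  rep_eq_of_toL2_eq <| by
    rw [map_add, map_neg, toL2_rep]
    exact (wd_chemPot hζ c₀ u).1.symm

lemma steadyOp_eq (β : ℝ) : steadyOp hζ c₀ u β = - wd u 4 + toL2 (potentialD c₀ u * rep 1 u +
    potential c₀ u * rep 2 u + analyticRestr hζ.deriv.deriv) - β • wd u 1 := by
  rw [steadyOp, (wd_chemPot hζ c₀ u).2]

/-- In expanded form the operator is a polynomial in continuous linear maps, with products taken in
the Banach algebra `C[0, L]`. -/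
lemma contDiff_steadyOp {n : WithTop ℕ∞} :
    ContDiff ℝ n fun p : ℝ × Sobolev 4 L => steadyOp hζ c₀ p.2 p.1 := by
  simp only [steadyOp_eq, potentialD, potential, shift]
  simp only [← wdL_apply]
  fun_prop

/-- The linearization `h ↦ (-h_xx + (3 (u + c₀)² - 1) h)_xx` of the steady state operator. -/
def linOp : Sobolev 4 L →L[ℝ] L2 L :=
  - wdL 4 + toL2 ∘L (ContinuousLinearMap.mul ℝ (CI L) (potentialDD c₀ u) ∘L rep 0 +
    (2 : ℝ) • (ContinuousLinearMap.mul ℝ (CI L) (potentialD c₀ u) ∘L rep 1) +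
    ContinuousLinearMap.mul ℝ (CI L) (potential c₀ u) ∘L rep 2)

lemma linOp_apply (h : Sobolev 4 L) : linOp c₀ u h = - wd h 4 + toL2 (potentialDD c₀ u * rep 0 h +
    (2 : ℝ) • (potentialD c₀ u * rep 1 h) + potential c₀ u * rep 2 h) := rfl

lemma hasFDerivAt_steadyOp :
    HasFDerivAt (fun v : Sobolev 4 L => steadyOp hζ c₀ v 0) (linOp c₀ u) u := by
  simp only [steadyOp_eq, potentialD, potential, shift]
  simp only [← wdL_apply, zero_smul, sub_zero]
  have r (k : Fin 4) : HasFDerivAt (fun v : Sobolev 4 L => rep k v) (rep k) u :=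
    (rep k).hasFDerivAt
  have hW := (r 0).add_const (ContinuousMap.const _ c₀)
  have h1 := (((hW.mul (r 1)).const_smul (6 : ℝ)).mul (r 1)).add
    (((((hW.mul hW).const_smul (3 : ℝ)).sub_const 1)).mul (r 2))
  have h2 := (toL2 (L := L)).hasFDerivAt.comp u (h1.add_const (analyticRestr hζ.deriv.deriv))
  refine ((wdL 4).hasFDerivAt.neg.add h2).congr_fderiv ?_
  ext1 h
  rw [linOp_apply]
  simp only [add_apply, neg_apply, wdL_apply, ContinuousLinearMap.comp_apply]
  congr 2
  ext x
  simp [potentialDD, potentialD, potential, shift]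
  ring

/-- The element `-h_xx + (3 (u + c₀)² - 1) h` of `H²(0, L)`. -/
lemma exists_linPot (h : Sobolev 4 L) : ∃ p : Sobolev 2 L,
    wd p 0 = - wd h 2 + toL2 (potential c₀ u * rep 0 h) ∧
    wd p 1 = - wd h 3 + toL2 (potentialD c₀ u * rep 0 h + potential c₀ u * rep 1 h) ∧
    wd p 2 = linOp c₀ u h := by
  have d0 : HasDerivI (potential c₀ u * rep 0 h)
      (potentialD c₀ u * rep 0 h + potential c₀ u * rep 1 h) :=
    (hasDerivI_potential c₀ u).mul (hasDerivI_rep 0 h)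
  have d1 : HasDerivI (potentialD c₀ u * rep 0 h + potential c₀ u * rep 1 h)
      (potentialDD c₀ u * rep 0 h + (2 : ℝ) • (potentialD c₀ u * rep 1 h) +
        potential c₀ u * rep 2 h) := by
    refine (((hasDerivI_potentialD c₀ u).mul (hasDerivI_rep 0 h)).add
      ((hasDerivI_potential c₀ u).mul (hasDerivI_rep 1 h))).of_eq ?_
    ext x
    simp
    ring
  obtain ⟨p, h0, h1, h2⟩ := exists_sobolev_two d0 d1
  refine ⟨- tailSobolev (tailSobolev h) + p, ?_, ?_, ?_⟩
  · rw [wd_add, h0]; rfl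
  · rw [wd_add, h1]; rfl
  · rw [wd_add, h2]; rfl

/-- Translates the pointwise expression `linPot` into an identity in `L²`. -/
lemma linPot_ae_eq {h h₂ : ℝ → ℝ} {f : CI L} {g : L2 L} (hf : h =ᵐ[vol L] extend f)
    (hg : h₂ =ᵐ[vol L] g) :
    linPot c₀ u h h₂ =ᵐ[vol L] (- g + toL2 (potential c₀ u * f) : L2 L) := by
  filter_upwards [Lp.coeFn_add (- g) (toL2 (potential c₀ u * f)), Lp.coeFn_neg g,
    coeFn_toL2 (potential c₀ u * f), coeFn_wd_castSucc 0 u, hf, hg] with x h1 h2 h3 h4 h5 h6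
  have h4' : wd u 0 x = extend (rep 0 u) x := h4
  rw [h1, Pi.add_apply, h2, h3, linPot, h4', h5, h6]
  simp only [potential, shift, extend_mul, extend_sub, extend_smul, extend_add, extend_const,
    extend_one, Pi.neg_apply]
  ring

end ChemPot

/-! ### The shooting function and its derivative -/

section Shooting

lemma HasDerivI.eq_primC {L : ℝ} [Fact (0 < L)] {f f' : CI L} (h : HasDerivI f f')
    (h0 : extend f 0 = 0) : f = primC f' := by
  have := h.eq_add_primC
  rw [h0] at this
  exact this.trans (zero_add _)

lemma hasDerivI_restr {L : ℝ} [Fact (0 < L)] {f f' : ℝ → ℝ} (hf : ContinuousOn f (Icc 0 L))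
    {g : CI L} (hg : ∀ x ∈ Icc 0 L, extend g x = f' x)
    (h : ∀ x ∈ Icc 0 L, HasDerivWithinAt f (f' x) (Icc 0 L) x) : HasDerivI (restr hf) g := by
  intro x hx
  rw [hg x hx]
  exact (h x hx).congr (fun y hy => extend_restr _ hy) (extend_restr _ hx)

lemma primC_const {L : ℝ} [Fact (0 < L)] (c : ℝ) :
    primC (ContinuousMap.const _ c : CI L) = c • idI := by
  refine (HasDerivI.eq_primC ((hasDerivI_idI.smul c).of_eq ?_) ?_).symm
  · ext x; simp
  · simp [extend_idI zero_mem_I]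

lemma eq_zero_of_volterra {L : ℝ} [Fact (0 < L)] {q f : CI L}
    (h : f = primC (primC (q * f))) : f = 0 := by
  refine (volterraEquiv q).injective ?_
  rw [map_zero, volterraEquiv_apply, ← h, sub_self]

/-- The difference of two solutions satisfies a homogeneous linear Volterra equation. Hence `shoot`
does not depend on the solution chosen in its definition. -/
lemma IsShootingSolution.unique {ζ : ℝ → ℝ} {c₀ L z : ℝ} {v w v' w' : ℝ → ℝ}
    (h : IsShootingSolution ζ c₀ L z v w) (h' : IsShootingSolution ζ c₀ L z v' w') :
    w 1 = w' 1 := by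
  have : Fact ((0 : ℝ) < 1) := ⟨one_pos⟩
  have cv : ContinuousOn v (Icc 0 1) := fun y hy => (h.hasDeriv y hy).continuousWithinAt
  have cv' : ContinuousOn v' (Icc 0 1) := fun y hy => (h'.hasDeriv y hy).continuousWithinAt
  have cw : ContinuousOn w (Icc 0 1) := fun y hy => (h.ode y hy).continuousWithinAt
  have cw' : ContinuousOn w' (Icc 0 1) := fun y hy => (h'.ode y hy).continuousWithinAt
  -- The coefficient comes from `a³ - a - (b³ - b) = (a² + a b + b² - 1)(a - b)`.
  have cp : ContinuousOn (fun y => L ^ 2 * (v y ^ 2 + v y * v' y + v' y ^ 2 - 1)) (Icc 0 1) := by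
    fun_prop
  have d0 : HasDerivI (restr (cv.sub cv')) (restr (cw.sub cw')) :=
    hasDerivI_restr _ (fun x hx => extend_restr _ hx)
      fun y hy => (h.hasDeriv y hy).sub (h'.hasDeriv y hy)
  have d1 : HasDerivI (restr (cw.sub cw')) (restr cp * restr (cv.sub cv')) := by
    refine hasDerivI_restr _ (fun x hx => ?_) fun y hy => (h.ode y hy).sub (h'.ode y hy)
    rw [extend_mul, extend_restr _ hx, extend_restr _ hx, Pi.sub_apply]
    ring
  have e0 := d0.eq_primC (by rw [extend_restr _ zero_mem_I]; simp [h.init, h'.init])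
  have e1 := d1.eq_primC (by rw [extend_restr _ zero_mem_I]; simp [h.init_deriv, h'.init_deriv])
  rw [e1] at e0
  have e2 := eq_zero_of_volterra e0
  rw [e2, mul_zero, map_zero] at e1
  have e3 := congrArg (fun f => extend f 1) e1
  simp only [extend_restr _ (end_mem_I (L := (1 : ℝ))), extend_zero] at e3
  exact sub_eq_zero.1 e3

lemma shoot_eq {ζ : ℝ → ℝ} {c₀ L z : ℝ} {v w : ℝ → ℝ} (h : IsShootingSolution ζ c₀ L z v w) :
    shoot ζ c₀ L z = w 1 := by
  have hs : Shootable ζ c₀ L z := ⟨v, w, h⟩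
  rw [shoot, dif_pos hs]
  exact hs.choose_spec.choose_spec.unique h

variable {L : ℝ} [hL : Fact (0 < L)] {ζ : ℝ → ℝ} (hζ : AnalyticOnNhd ℝ ζ (Ici 0)) (c₀ : ℝ)

/-- The right hand side of the stationary equation `v_xx = v³ - v + ζ`. -/
def cubic (V : CI L) : CI L := V * V * V - V + analyticRestr hζ

/-- The integrated initial value problem `v = c₀ + (s / L) x + ∫∫ (v³ - v + ζ)`. -/
def integratedIVP (p : ℝ × CI L) : CI L :=
  p.2 - ContinuousMap.const _ c₀ - (p.1 / L) • idI - primC (primC (cubic hζ p.2))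

lemma contDiff_integratedIVP {n : WithTop ℕ∞} :
    ContDiff ℝ n (integratedIVP hζ c₀ : ℝ × CI L → CI L) := by
  unfold integratedIVP cubic
  fun_prop

/-- The rescaling `x = L y`: slopes in `y` are `L` times slopes in `x`, so the initial slope `s`
becomes `s / L`, and second derivatives acquire `L²`. -/
lemma isShootingSolution_of_integratedIVP {s : ℝ} {V : CI L}
    (h : integratedIVP hζ c₀ (s, V) = 0) :
    IsShootingSolution ζ c₀ L s (fun y => extend V (L * y))
      (fun y => L * extend (ContinuousMap.const _ (s / L) + primC (cubic hζ V)) (L * y)) := by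
  have hV : V = ContinuousMap.const _ c₀ +
      primC (ContinuousMap.const _ (s / L) + primC (cubic hζ V)) := by
    rw [map_add, primC_const]
    simp only [integratedIVP] at h
    rw [sub_sub, sub_sub, sub_eq_zero] at h
    exact h
  have d0 : HasDerivI V (ContinuousMap.const _ (s / L) + primC (cubic hζ V)) := by
    conv => arg 1; rw [hV]
    exact hasDerivI_const_add_primC _ _
  have d1 : HasDerivI (ContinuousMap.const _ (s / L) + primC (cubic hζ V)) (cubic hζ V) :=
    hasDerivI_const_add_primC _ _
  have maps : MapsTo (fun y => L * y) (Icc 0 1) (Icc 0 L) := fun y hy =>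
    ⟨mul_nonneg hL.out.le hy.1, mul_le_of_le_one_right hL.out.le hy.2⟩
  have dl (y : ℝ) : HasDerivWithinAt (fun y => L * y) L (Icc 0 1) y := by
    simpa using ((hasDerivAt_id y).const_mul L).hasDerivWithinAt
  refine ⟨fun y hy => ?_, fun y hy => ?_, ?_, ?_⟩
  · exact ((d0 _ (maps hy)).comp y (dl y) maps).congr_deriv (mul_comm _ _)
  · refine (((d1 _ (maps hy)).comp y (dl y) maps).const_mul L).congr_deriv ?_
    simp only [cubic, extend_add, extend_sub, extend_mul, analyticRestr]
    rw [extend_restr _ (maps hy)]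
    ring
  · show extend V (L * 0) = c₀
    rw [hV, mul_zero]
    simp
  · show L * extend (ContinuousMap.const _ (s / L) + primC (cubic hζ V)) (L * 0) = s
    rw [mul_zero]
    simp [mul_div_cancel₀ _ hL.out.ne']

omit hL in
lemma hasFDerivAt_cubic (V : CI L) : HasFDerivAt (cubic hζ)
    (ContinuousLinearMap.mul ℝ (CI L) ((3 : ℝ) • (V * V) - 1)) V := by
  have h := hasFDerivAt_id (𝕜 := ℝ) V
  refine ((((h.mul h).mul h).sub h).add_const (analyticRestr hζ)).congr_fderiv ?_
  ext1 f
  ext x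
  simp
  ring

/-- The shooting function is differentiable at every slope for which the problem is solvable; its
derivative is the endpoint slope of the solution of the linearized problem. -/
lemma hasDerivAt_shoot {z : ℝ} {V q : CI L} (h : integratedIVP hζ c₀ (z, V) = 0)
    (hq : q = (3 : ℝ) • (V * V) - 1) :
    HasDerivAt (fun s => shoot ζ c₀ L s)
      (1 + extend (primC (q * (volterraEquiv q).symm idI)) L) z := by
  have cdf : ContDiffAt ℝ 1 (integratedIVP hζ c₀ : ℝ × CI L → CI L) (z, V) :=
    (contDiff_integratedIVP hζ c₀).contDiffAt
  -- The partial derivative in the function variable is `1 - volterra q`, which is always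
  -- invertible; hence solutions persist and depend differentiably on the slope.
  have hpart : fderiv ℝ (integratedIVP hζ c₀) (z, V) ∘L .inr ℝ ℝ (CI L) =
      (volterraEquiv q : CI L →L[ℝ] CI L) := by
    have h1 := (cdf.differentiableAt one_ne_zero).hasFDerivAt.comp V
      (hasFDerivAt_prodMk_right (𝕜 := ℝ) z V)
    refine h1.unique ?_
    have h2 := (primC ∘L primC (L := L)).hasFDerivAt.comp V (hasFDerivAt_cubic hζ V)
    have h3 := ((hasFDerivAt_id (𝕜 := ℝ) V).sub_const (ContinuousMap.const _ c₀)).sub_const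
      ((z / L) • idI)
    rw [← hq] at h2
    exact h3.sub h2
  have if₂ : (fderiv ℝ (integratedIVP hζ c₀) (z, V) ∘L .inr ℝ ℝ (CI L)).IsInvertible :=
    ⟨volterraEquiv q, hpart.symm⟩
  set ψ : ℝ → CI L := cdf.implicitFunction one_ne_zero if₂ with hψ
  have ψz : ψ z = V := cdf.implicitFunction_apply_self one_ne_zero if₂
  have ψ0 : ∀ᶠ s in nhds z, integratedIVP hζ c₀ (s, ψ s) = 0 := by
    filter_upwards [cdf.eventually_apply_implicitFunction one_ne_zero if₂] with s hs
    exact hs.trans h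
  obtain ⟨d, hd⟩ : ∃ d, HasDerivAt ψ d z :=
    ⟨_, (cdf.hasStrictFDerivAt_implicitFunction one_ne_zero if₂).hasFDerivAt.hasDerivAt⟩
  have hcub : HasDerivAt (fun s => cubic hζ (ψ s)) (q * d) z := by
    have h1 := hasFDerivAt_cubic hζ (ψ z)
    rw [ψz, ← hq, ← ψz] at h1
    exact h1.comp_hasDerivAt z hd
  have hJ : HasDerivAt (fun s => primC (cubic hζ (ψ s))) (primC (q * d)) z :=
    (primC (L := L)).hasFDerivAt.comp_hasDerivAt z hcub
  have hJJ : HasDerivAt (fun s => primC (primC (cubic hζ (ψ s)))) (primC (primC (q * d))) z :=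
    (primC (L := L)).hasFDerivAt.comp_hasDerivAt z hJ
  have hs : HasDerivAt (fun s : ℝ => s / L) (1 / L) z := (hasDerivAt_id z).div_const L
  -- Differentiating the fixed point equation in the slope gives the linearized problem, so `d = φ /
  -- L`.
  have hd1 : d = (1 / L) • idI + primC (primC (q * d)) := by
    have h1 : HasDerivAt (fun s => ContinuousMap.const _ c₀ + (s / L) • idI +
        primC (primC (cubic hζ (ψ s)))) ((1 / L) • idI + primC (primC (q * d))) z :=
      ((hs.smul_const (idI : CI L)).const_add _).add hJJ
    refine hd.unique (h1.congr_of_eventuallyEq ?_)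
    filter_upwards [ψ0] with s hs
    simp only [integratedIVP] at hs
    rwa [sub_sub, sub_sub, sub_eq_zero, ← add_assoc] at hs
  have hd2 : d = (1 / L) • (volterraEquiv q).symm idI := by
    rw [← map_smul, ContinuousLinearEquiv.eq_symm_apply, volterraEquiv_apply, sub_eq_iff_eq_add]
    exact hd1
  -- Near `z` the implicit function supplies genuine shooting solutions, so the default value of
  -- `shoot` plays no role there.
  have hsh : (fun s => shoot ζ c₀ L s) =ᶠ[nhds z]
      fun s => s + L * evalCI L (primC (cubic hζ (ψ s))) := by
    filter_upwards [ψ0] with s hs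
    rw [shoot_eq (isShootingSolution_of_integratedIVP hζ c₀ hs)]
    have := hL.out.ne'
    simp
    field_simp
  refine HasDerivAt.congr_of_eventuallyEq ?_ hsh
  have h1 := (hasDerivAt_id z).add
    (((evalCI L).hasFDerivAt.comp_hasDerivAt z hJ).const_mul L)
  refine h1.congr_deriv ?_
  have := hL.out.ne'
  rw [hd2]
  simp
  field_simp

/-- The derivative `p_x` is constant and vanishes at `L`, so `p` is constant and vanishes at `0`. It
serves both for `μ(u)` and for the outer factor of the linearization. -/
lemma eq_zero_of_boundary {p : Sobolev 2 L} (h2 : wd p 2 = 0) (h0 : extend (rep 0 p) 0 = 0)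
    (h1 : extend (rep 1 p) L = 0) : p = 0 := by
  have e1 := rep_eq_const_add_prim 1 p
  have h2' : wd p (Fin.succ 1) = 0 := h2
  rw [h2', map_zero, add_zero] at e1
  have e2 : extend (rep 1 p) 0 = 0 := by
    rw [e1, extend_const] at h1
    exact h1
  have e3 : rep 1 p = 0 := by rw [e1, e2]; rfl
  have e4 : rep 0 p = primC (rep 1 p) := (hasDerivI_rep 0 p).eq_primC h0
  have e5 : rep 0 p = 0 := by rw [e4, e3, map_zero]
  refine Sobolev.ext_wd_zero ?_
  have := toL2_rep 0 p
  rw [e5, map_zero] at this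
  exact this.symm

lemma mem_stateSpace_iff (u : Sobolev 4 L) : u ∈ stateSpace L hζ c₀ ↔
    extend (rep 0 u) 0 = 0 ∧ extend (rep 1 u) L = 0 ∧
    extend (rep 0 (chemPot hζ c₀ u)) 0 = 0 ∧ extend (rep 1 (chemPot hζ c₀ u)) L = 0 := by
  rw [← hasBoundaryValue_iff 0 u zero_mem_I, ← hasBoundaryValue_iff 1 u end_mem_I,
    ← hasBoundaryValue_iff 0 (chemPot hζ c₀ u) zero_mem_I,
    ← hasBoundaryValue_iff 1 (chemPot hζ c₀ u) end_mem_I]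
  rfl

lemma chemPot_eq_zero {u : Sobolev 4 L} (hu : IsSteadyState hζ c₀ 0 u) : chemPot hζ c₀ u = 0 := by
  obtain ⟨hX, h⟩ := hu
  rw [mem_stateSpace_iff] at hX
  refine eq_zero_of_boundary ?_ hX.2.2.1 hX.2.2.2
  simpa [steadyOp] using h

lemma rep_two_eq_cubic {u : Sobolev 4 L} (hu : IsSteadyState hζ c₀ 0 u) :
    rep 2 u = cubic hζ (shift c₀ u) := by
  have := rep_chemPot_zero hζ c₀ u
  rw [chemPot_eq_zero hζ c₀ hu, map_zero] at this
  exact neg_add_eq_zero.1 this.symm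

lemma integratedIVP_of_isSteadyState {u : Sobolev 4 L} (hu : IsSteadyState hζ c₀ 0 u) :
    integratedIVP hζ c₀ (L * extend (rep 1 u) 0, shift c₀ u) = 0 := by
  have h2 := rep_two_eq_cubic hζ c₀ hu
  have e1 := (hasDerivI_rep 1 u).eq_add_primC
  have e0 := (hasDerivI_rep 0 u).eq_primC ((mem_stateSpace_iff hζ c₀ u).1 hu.1).1
  have e0' : rep 0 u = primC (rep 1 u) := e0
  have e1' : rep 1 u = ContinuousMap.const _ (extend (rep 1 u) 0) + primC (rep 2 u) := e1
  rw [h2] at e1'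
  simp only [integratedIVP]
  rw [mul_div_cancel_left₀ _ hL.out.ne', sub_sub, sub_sub, sub_eq_zero, ← primC_const, ← map_add,
    ← e1', ← e0', shift, add_comm]

/-- Away from the exceptional lengths, the linearized problem with zero initial value and nonzero
initial slope has nonzero slope at `L`. -/
lemma endpoint_slope_ne_zero {u : Sobolev 4 L} (hu : IsSteadyState hζ c₀ 0 u)
    (hE : L ∉ exceptionalSet ζ c₀) :
    1 + extend (primC (potential c₀ u * (volterraEquiv (potential c₀ u)).symm idI)) L ≠ 0 := by
  intro h0
  have h := integratedIVP_of_isSteadyState hζ c₀ hu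
  have hd := hasDerivAt_shoot hζ c₀ h (q := potential c₀ u) rfl
  rw [h0] at hd
  have hs := isShootingSolution_of_integratedIVP hζ c₀ h
  -- The slope `L u_x(0)` is a zero of `f(L, ·)` because `u_x(L) = 0`; a vanishing `φ_x(L)` would
  -- make it degenerate and put `L` in `E`.
  refine hE ⟨hL.out, L * extend (rep 1 u) 0, ⟨⟨_, _, hs⟩, ?_⟩, hd⟩
  rw [shoot_eq hs]
  have e1 : rep 1 u = ContinuousMap.const _ (extend (rep 1 u) 0) + primC (rep 2 u) :=
    (hasDerivI_rep 1 u).eq_add_primC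
  have h2 := rep_two_eq_cubic hζ c₀ hu
  rw [mul_div_cancel_left₀ _ hL.out.ne', ← h2, ← e1, mul_one,
    ((mem_stateSpace_iff hζ c₀ u).1 hu.1).2.1, mul_zero]

end Shooting

/-! ### Bijectivity of the linearization -/

section Linearization

variable {L : ℝ} [hL : Fact (0 < L)]

lemma mem_domain₂_iff (h : Sobolev 2 L) :
    h ∈ domain₂ L ↔ extend (rep 0 h) 0 = 0 ∧ extend (rep 1 h) L = 0 := by
  rw [← hasBoundaryValue_iff 0 h zero_mem_I, ← hasBoundaryValue_iff 1 h end_mem_I]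
  change (∀ p ∈ ({(0, 0), (1, L)} : Set (Fin 3 × ℝ)), HasBoundaryValue L (wd h p.1) p.2 0) ↔ _
  simp only [mem_insert_iff, mem_singleton_iff, forall_eq_or_imp, forall_eq]
  rfl

lemma mem_tangentSpace_iff (h : Sobolev 4 L) :
    h ∈ tangentSpace L ↔ extend (rep 0 h) 0 = 0 ∧ extend (rep 1 h) L = 0 ∧
      extend (rep 2 h) 0 = 0 ∧ extend (rep 3 h) L = 0 := by
  rw [← hasBoundaryValue_iff 0 h zero_mem_I, ← hasBoundaryValue_iff 1 h end_mem_I,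
    ← hasBoundaryValue_iff 2 h zero_mem_I, ← hasBoundaryValue_iff 3 h end_mem_I]
  change (∀ p ∈ ({(0, 0), (1, L), (2, 0), (3, L)} : Set (Fin 5 × ℝ)),
    HasBoundaryValue L (wd h p.1) p.2 0) ↔ _
  simp only [mem_insert_iff, mem_singleton_iff, forall_eq_or_imp, forall_eq]
  rfl

lemma isClosed_tangentSpace : IsClosed (tangentSpace L : Set (Sobolev 4 L)) := by
  have : (tangentSpace L : Set (Sobolev 4 L)) =
      {h | evalCI 0 (rep 0 h) = 0} ∩ ({h | evalCI L (rep 1 h) = 0} ∩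
        ({h | evalCI 0 (rep 2 h) = 0} ∩ {h | evalCI L (rep 3 h) = 0})) := by
    ext h
    exact mem_tangentSpace_iff h
  rw [this]
  have c (x : ℝ) (k : Fin 4) : IsClosed {h : Sobolev 4 L | evalCI x (rep k h) = 0} :=
    isClosed_eq ((evalCI x ∘L rep k).continuous) continuous_const
  exact (c _ _).inter ((c _ _).inter ((c _ _).inter (c _ _)))

instance : CompleteSpace (tangentSpace L) := isClosed_tangentSpace.completeSpace_coe

variable (c₀ : ℝ) {u : Sobolev 4 L}

/-- With `h(0) = 0` the equation makes `h` the multiple `η φ`, `η = h_x(0)`. Then `h_x(L) = η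
φ_x(L)`, and `hne` says `φ_x(L) ≠ 0`. -/
lemma eq_zero_of_linPot_eq_zero
    (hne : 1 + extend (primC (potential c₀ u * (volterraEquiv (potential c₀ u)).symm idI)) L ≠ 0)
    {h : Sobolev 2 L} (hd : h ∈ domain₂ L)
    (h0 : linPot c₀ u (wd h 0) (wd h 2) =ᵐ[vol L] 0) : h = 0 := by
  rw [mem_domain₂_iff] at hd
  set q := potential c₀ u
  have e2 : wd h 2 = toL2 (q * rep 0 h) := by
    have h1 := linPot_ae_eq c₀ u (coeFn_wd_castSucc 0 h) (ae_eq_refl (wd h 2))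
    have h2 : - wd h 2 + toL2 (q * rep 0 h) = 0 :=
      Lp.ext (h1.symm.trans (h0.trans (Lp.coeFn_zero _ _ _).symm))
    exact neg_add_eq_zero.1 h2
  set η := extend (rep 1 h) 0
  have e1 : rep 1 h = ContinuousMap.const _ η + primC (q * rep 0 h) := by
    have := rep_eq_const_add_prim 1 h
    rwa [show wd h (Fin.succ 1) = toL2 (q * rep 0 h) from e2] at this
  have e0 : rep 0 h = primC (rep 1 h) := (hasDerivI_rep 0 h).eq_primC hd.1
  have e3 : rep 0 h = η • (volterraEquiv q).symm idI := by
    rw [← map_smul, ContinuousLinearEquiv.eq_symm_apply, volterraEquiv_apply, sub_eq_iff_eq_add,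
      ← primC_const, ← map_add, ← e1, ← e0]
  have e4 : η = 0 := by
    have h1 := hd.2
    rw [e1, e3, mul_smul_comm, map_smul, extend_add, extend_const, extend_smul] at h1
    have h2 : η * (1 + extend (primC (q * (volterraEquiv q).symm idI)) L) = 0 := by
      rw [mul_add, mul_one]; exact h1
    exact (mul_eq_zero.1 h2).resolve_right hne
  refine Sobolev.ext_wd_zero ?_
  have := toL2_rep 0 h
  rw [e3, e4, zero_smul, map_zero] at this
  exact this.symm

/-- Since `q_x = 6 (u + c₀) u_x`, the term `q_x h` drops out of `(-h_xx + q h)_x` at `L`. The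
conditions at `L` thereby pass between `h` and `-h_xx + q h`. -/
lemma extend_potentialD_end (hu : extend (rep 1 u) L = 0) : extend (potentialD c₀ u) L = 0 := by
  rw [potentialD, extend_smul, extend_mul, hu]
  ring

/-- The function `p = -h_xx + q h` inherits `p(0) = p_x(L) = 0`, so `p_xx = 0` gives `p = 0`; the
second order kernel is trivial too. -/
lemma linOp_injective
    (hne : 1 + extend (primC (potential c₀ u * (volterraEquiv (potential c₀ u)).symm idI)) L ≠ 0)
    (hu : extend (rep 1 u) L = 0) {h : Sobolev 4 L} (hT : h ∈ tangentSpace L)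
    (h0 : linOp c₀ u h = 0) : h = 0 := by
  rw [mem_tangentSpace_iff] at hT
  obtain ⟨t0, t1, t2, t3⟩ := hT
  obtain ⟨p, p0, p1, p2⟩ := exists_linPot c₀ u h
  have r0 : rep 0 p = - rep 2 h + potential c₀ u * rep 0 h := rep_eq_of_toL2_eq <| by
    rw [map_add, map_neg, toL2_rep]; exact p0.symm
  have r1 : rep 1 p = - rep 3 h + (potentialD c₀ u * rep 0 h + potential c₀ u * rep 1 h) :=
    rep_eq_of_toL2_eq <| by
      rw [map_add toL2 (-rep 3 h), map_neg, toL2_rep]; exact p1.symm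
  have hp : p = 0 := by
    refine eq_zero_of_boundary (p2.trans h0) ?_ ?_
    · simp [r0, t0, t2]
    · simp [r1, t1, t3, extend_potentialD_end c₀ hu]
  have i0 : rep 0 (initSobolev (initSobolev h)) = rep 0 h :=
    rep_eq_of_toL2_eq (toL2_rep 0 h)
  have i1 : rep 1 (initSobolev (initSobolev h)) = rep 1 h :=
    rep_eq_of_toL2_eq (toL2_rep 1 h)
  have hi : initSobolev (initSobolev h) = 0 := by
    refine eq_zero_of_linPot_eq_zero c₀ hne ?_ ?_
    · rw [mem_domain₂_iff, i0, i1]; exact ⟨t0, t1⟩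
    · refine (linPot_ae_eq c₀ u (coeFn_wd_castSucc 0 h) (ae_eq_refl (wd h 2))).trans ?_
      rw [← p0, hp]
      exact Lp.coeFn_zero _ _ _
  refine Sobolev.ext_wd_zero ?_
  have : wd (initSobolev (initSobolev h)) 0 = 0 := by rw [hi]; rfl
  exact this

lemma linOp_surjective
    (hne : 1 + extend (primC (potential c₀ u * (volterraEquiv (potential c₀ u)).symm idI)) L ≠ 0)
    (hu : extend (rep 1 u) L = 0) (g : L2 L) : ∃ h ∈ tangentSpace L, linOp c₀ u h = g := by
  set q := potential c₀ u
  set φ := (volterraEquiv q).symm idI with hφ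
  -- Solves `p_xx = g`; the initial slope `-∫₀ᴸ g` is forced by `p_x(L) = 0`.
  set p : Sobolev 2 L := consSobolev 0 (consSobolev (- extend (prim g) L) (ofL2 g))
  have p2 : wd p 2 = g := rfl
  have p1 : rep 1 p = ContinuousMap.const _ (- extend (prim g) L) + prim g :=
    rep_eq_of_toL2_eq rfl
  have p1L : extend (rep 1 p) L = 0 := by simp [p1]
  have p00 : extend (rep 0 p) 0 = 0 := by
    have : rep 0 p = ContinuousMap.const _ 0 + prim (wd p 1) := rep_eq_of_toL2_eq rfl
    simp [this]
  -- The particular solution of `-ψ_xx + q ψ = p` with zero initial data.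
  set ψ := (volterraEquiv q).symm (- primC (primC (rep 0 p))) with hψ
  -- The multiple of `φ` that makes the slope of `ψ + η φ` vanish at `L`; the denominator is
  -- `φ_x(L)`.
  set η := - extend (primC (q * ψ - rep 0 p)) L / (1 + extend (primC (q * φ)) L) with hη
  set h0 := ψ + η • φ with hh0
  set h2 := q * h0 - rep 0 p with hh2
  set h1 := ContinuousMap.const _ η + primC h2 with hh1
  have e0 : h0 = primC h1 := by
    rw [hh1, map_add, primC_const, hh2, map_sub, map_sub]
    have k1 := volterraEquiv_symm_eq q idI
    have k2 := volterraEquiv_symm_eq q (- primC (primC (rep 0 p)))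
    rw [← hφ] at k1
    rw [← hψ] at k2
    rw [hh0, mul_add, map_add, map_add, mul_smul_comm, map_smul, map_smul]
    nth_rewrite 1 [k1]
    nth_rewrite 1 [k2]
    module
  have h1L : extend h1 L = 0 := by
    have k : h2 = (q * ψ - rep 0 p) + η • (q * φ) := by
      rw [hh2, hh0, mul_add, mul_smul_comm]; abel
    rw [hh1, k, map_add, map_smul, extend_add, extend_const, extend_add, extend_smul, hη]
    field_simp
    ring
  have d0 : HasDerivI h0 h1 := e0 ▸ hasDerivI_primC h1
  have d1 : HasDerivI h1 h2 := hasDerivI_const_add_primC _ _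
  have dq := (hasDerivI_potential c₀ u).mul d0
  obtain ⟨Q, Q0, Q1, -⟩ := exists_sobolev_two dq
    (((hasDerivI_potentialD c₀ u).mul d0).add ((hasDerivI_potential c₀ u).mul d1))
  have r2 : toL2 h2 = wd (Q - p) 0 := by
    rw [wd_sub, Q0, hh2, map_sub, toL2_rep]; rfl
  -- Regularity: `h_xx = q h - p` lies in `H²`, being `Q - p`, so two antiderivatives place `h` in
  -- `H⁴`.
  set H : Sobolev 4 L := consSobolev 0 (consSobolev η (Q - p)) with hH
  have H1 : toL2 h1 = wd (consSobolev η (Q - p)) 0 := by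
    rw [wd_consSobolev_zero, ← r2]; rfl
  have H0 : toL2 h0 = wd H 0 := by
    rw [hH, wd_consSobolev_zero, ← H1, e0]
    exact congrArg toL2 (zero_add _).symm
  have R0 : rep 0 H = h0 := rep_eq_of_toL2_eq H0
  have R1 : rep 1 H = h1 := rep_eq_of_toL2_eq H1
  have R2 : rep 2 H = h2 := rep_eq_of_toL2_eq r2
  have R3 : rep 3 H = (potentialD c₀ u * h0 + potential c₀ u * h1) - rep 1 p :=
    rep_eq_of_toL2_eq <| by
      rw [map_sub toL2 (potentialD c₀ u * h0 + potential c₀ u * h1), ← Q1, toL2_rep]; rfl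
  have h00 : extend h0 0 = 0 := by rw [e0]; simp
  refine ⟨H, ?_, ?_⟩
  · rw [mem_tangentSpace_iff, R0, R1, R2, R3]
    refine ⟨h00, h1L, ?_, ?_⟩
    · simp [hh2, h00, p00]
    · simp [h1L, extend_potentialD_end c₀ hu, p1L]
  · obtain ⟨p', k0, -, k2⟩ := exists_linPot c₀ u H
    have : p' = p := by
      refine Sobolev.ext_wd_zero ?_
      have w2 : wd H 2 = toL2 h2 := r2.symm
      rw [k0, R0, w2, hh2, map_sub, toL2_rep, neg_sub]
      exact sub_add_cancel _ _
    rw [← k2, this, p2]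

end Linearization

/-! ### The implicit function theorem and the branch of steady states -/

lemma exists_implicit_branch {E F : Type*} [NormedAddCommGroup E] [NormedSpace ℝ E]
    [CompleteSpace E] [NormedAddCommGroup F] [NormedSpace ℝ F] [CompleteSpace F] {f : ℝ × E → F}
    (hf : ContDiff ℝ 1 f) (hf0 : f (0, 0) = 0) (A : E ≃L[ℝ] F)
    (hA : HasFDerivAt (fun h => f (0, h)) (A : E →L[ℝ] F) 0) :
    ∃ r : ℝ, 0 < r ∧ ∃ ψ : ℝ → E, ContDiffOn ℝ 1 ψ (Ioo (-r) r) ∧ ψ 0 = 0 ∧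
      (∀ β ∈ Ioo (-r) r, f (β, ψ β) = 0) ∧
      ∃ C : ℝ, 0 < C ∧ ∀ β ∈ Ioo (-r) r, ‖ψ β‖ ≤ C * |β| := by
  have cdf : ContDiffAt ℝ 1 f (0, 0) := hf.contDiffAt
  have hpart : fderiv ℝ f (0, 0) ∘L .inr ℝ ℝ E = (A : E →L[ℝ] F) :=
    ((cdf.differentiableAt one_ne_zero).hasFDerivAt.comp (0 : E)
      (hasFDerivAt_prodMk_right (𝕜 := ℝ) (0 : ℝ) (0 : E))).unique hA
  have if₂ : (fderiv ℝ f (0, 0) ∘L .inr ℝ ℝ E).IsInvertible := ⟨A, hpart.symm⟩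
  set ψ : ℝ → E := cdf.implicitFunction one_ne_zero if₂
  have ψ0 : ψ 0 = 0 := cdf.implicitFunction_apply_self one_ne_zero if₂
  have ψc : ContDiffAt ℝ 1 ψ 0 := cdf.contDiffAt_implicitFunction one_ne_zero if₂
  have ψe : ∀ᶠ β in nhds 0, f (β, ψ β) = 0 := by
    filter_upwards [cdf.eventually_apply_implicitFunction one_ne_zero if₂] with β hβ
    exact hβ.trans hf0
  -- Differentiability at `0` alone gives the linear bound. The radius is then shrunk so that
  -- regularity, the equation and this bound hold together.
  obtain ⟨C, hC, hb⟩ := (ψc.differentiableAt one_ne_zero).hasFDerivAt.isBigO_sub.exists_pos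
  obtain ⟨r, hr, hball⟩ := Metric.eventually_nhds_iff_ball.1
    ((ψc.eventually (by simp)).and (ψe.and hb.bound))
  rw [Real.ball_eq_Ioo, zero_sub, zero_add] at hball
  refine ⟨r, hr, ψ, fun β hβ => (hball β hβ).1.contDiffWithinAt, ψ0,
    fun β hβ => (hball β hβ).2.1, C, hC, fun β hβ => ?_⟩
  have := (hball β hβ).2.2
  rwa [ψ0, sub_zero, sub_zero, Real.norm_eq_abs] at this

lemma contDiff_add_submodule {E F : Type*} [NormedAddCommGroup E] [NormedSpace ℝ E]
    [NormedAddCommGroup F] [NormedSpace ℝ F] (S : Submodule ℝ E) {n : WithTop ℕ∞} {f : ℝ × E → F}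
    (hf : ContDiff ℝ n f) (u : E) : ContDiff ℝ n fun p : ℝ × S => f (p.1, u + (p.2 : E)) :=
  hf.comp (contDiff_fst.prodMk (contDiff_const.add (S.subtypeL.contDiff.comp contDiff_snd)))

section Branch

local instance (L : ℝ) : NormedAddCommGroup (tangentSpace L) := Submodule.normedAddCommGroup _

local instance (L : ℝ) : NormedSpace ℝ (tangentSpace L) := Submodule.normedSpace _

variable {L : ℝ} [hL : Fact (0 < L)] {ζ : ℝ → ℝ} (hζ : AnalyticOnNhd ℝ ζ (Ici 0)) (c₀ : ℝ)
  {u : Sobolev 4 L}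

/-- Adding `h` changes neither `u(0)` nor `u_x(L)`. So the reaction part of `μ(0)` is unchanged, the
term `q u_x` in `μ_x(L)` stays zero, and the remaining changes `-h_xx(0)` and `-h_xxx(L)` vanish. -/
lemma add_mem_stateSpace (hu : u ∈ stateSpace L hζ c₀) {h : Sobolev 4 L}
    (hh : h ∈ tangentSpace L) : u + h ∈ stateSpace L hζ c₀ := by
  rw [mem_stateSpace_iff, rep_chemPot_zero, rep_chemPot_one] at hu ⊢
  rw [mem_tangentSpace_iff] at hh
  obtain ⟨u0, u1, u2, u3⟩ := hu
  obtain ⟨h0, h1, h2, h3⟩ := hh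
  simp only [reaction, shift, map_add, extend_add, extend_neg, extend_sub, extend_mul,
    extend_const, u0, u1, h0, h1, h2, h3, add_zero, mul_zero, zero_add] at u2 u3 ⊢
  exact ⟨trivial, trivial, u2, u3⟩

/-- The isomorphism from the tangent space onto `L²(0, L)` given by the linearization at `u`. -/
def linEquiv
    (hne : 1 + extend (primC (potential c₀ u * (volterraEquiv (potential c₀ u)).symm idI)) L ≠ 0)
    (hu : extend (rep 1 u) L = 0) : tangentSpace L ≃L[ℝ] L2 L :=
  ContinuousLinearEquiv.ofBijective (linOp c₀ u ∘L (tangentSpace L).subtypeL)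
    (LinearMap.ker_eq_bot'.2 fun h h0 => Subtype.ext (linOp_injective c₀ hne hu h.2 h0))
    (LinearMap.range_eq_top.2 fun g => by
      obtain ⟨h, hT, hg⟩ := linOp_surjective c₀ hne hu g
      exact ⟨⟨h, hT⟩, hg⟩)

lemma hasFDerivAt_steadyOp_add : HasFDerivAt
    (fun h : tangentSpace L => steadyOp hζ c₀ (u + (h : Sobolev 4 L)) 0)
    (linOp c₀ u ∘L (tangentSpace L).subtypeL) 0 := by
  have h1 : HasFDerivAt (fun v : Sobolev 4 L => steadyOp hζ c₀ v 0) (linOp c₀ u)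
      (u + ((0 : tangentSpace L) : Sobolev 4 L)) := by
    simpa using hasFDerivAt_steadyOp hζ c₀ u
  exact h1.comp (0 : tangentSpace L) ((tangentSpace L).subtypeL.hasFDerivAt.const_add u)

lemma contDiff_steadyOp_add : ContDiff ℝ 1
    fun p : ℝ × tangentSpace L => steadyOp hζ c₀ (u + (p.2 : Sobolev 4 L)) p.1 :=
  contDiff_add_submodule (tangentSpace L) (contDiff_steadyOp hζ c₀) u

lemma exists_branch (A : tangentSpace L ≃L[ℝ] L2 L)
    (hA : HasFDerivAt (fun h : tangentSpace L => steadyOp hζ c₀ (u + (h : Sobolev 4 L)) 0)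
      (A : tangentSpace L →L[ℝ] L2 L) 0) (hu : IsSteadyState hζ c₀ 0 u) :
    ∃ β₀ : ℝ, 0 < β₀ ∧ ∃ U : ℝ → Sobolev 4 L,
      ContDiffOn ℝ 1 U (Ioo (-β₀) β₀) ∧ U 0 = u ∧
      (∀ β ∈ Ioo (-β₀) β₀, IsSteadyState hζ c₀ β (U β)) ∧
      ∃ C : ℝ, 0 < C ∧ ∀ β ∈ Ioo (-β₀) β₀, ‖U β - u‖ ≤ C * |β| := by
  obtain ⟨β₀, hβ₀, ψ, ψc, ψ0, ψe, C, hC, hb⟩ := exists_implicit_branch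
    (contDiff_steadyOp_add hζ c₀ (u := u)) (by simpa using hu.2) A hA
  refine ⟨β₀, hβ₀, fun β => u + (tangentSpace L).subtypeL (ψ β), ?_, ?_, fun β hβ => ?_,
    C, hC, fun β hβ => ?_⟩
  · exact contDiffOn_const.add ((tangentSpace L).subtypeL.contDiff.comp_contDiffOn ψc)
  · simp [ψ0]
  · exact ⟨add_mem_stateSpace hζ c₀ hu.1 (ψ β).2, ψe β hβ⟩
  · rw [add_sub_cancel_left]
    exact hb β hβ

end Branch

end LangmuirBlodgett

end

open LangmuirBlodgett in
theorem mainTheorem7 (ζ : ℝ → ℝ) (hζ : AnalyticOnNhd ℝ ζ (Set.Ici 0))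
    (hrange : ∀ x : ℝ, 0 < x → ζ x ∈ Set.Ioo (-1 : ℝ) 0)
    (c₀ L : ℝ) (hL : 0 < L) (hE : L ∉ exceptionalSet ζ c₀)
    (u : Sobolev 4 L) (hu : IsSteadyState hζ c₀ 0 u) :
    -- the second order linearized operator at `u` has trivial kernel
    (∀ h ∈ domain₂ L, linPot c₀ u (wd h 0) (wd h 2) =ᵐ[vol L] 0 → h = 0) ∧
    -- the Fréchet derivative `A` of `𝓕(·, 0)` at `u`, along the tangent space of `X`, is
    -- `h ↦ (-h_xx + (3 (u + c₀)² - 1) h)_xx`, has trivial kernel and is an isomorphism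
    (∃ A : tangentSpace L ≃L[ℝ] L2 L,
      HasFDerivAt (fun h : tangentSpace L => steadyOp hζ c₀ (u + (h : Sobolev 4 L)) 0)
        (A : tangentSpace L →L[ℝ] L2 L) 0 ∧
      (∀ h : tangentSpace L, ∃ m : Sobolev 2 L,
        wd m 0 =ᵐ[vol L] linPot c₀ u (wd (h : Sobolev 4 L) 0) (wd (h : Sobolev 4 L) 2) ∧
        A h = wd m 2) ∧
      (∀ h : tangentSpace L, A h = 0 → h = 0)) ∧
    -- the branch of steady states
    (∃ β₀ : ℝ, 0 < β₀ ∧ ∃ U : ℝ → Sobolev 4 L,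
      ContDiffOn ℝ 1 U (Set.Ioo (-β₀) β₀) ∧ U 0 = u ∧
      (∀ β ∈ Set.Ioo (-β₀) β₀, IsSteadyState hζ c₀ β (U β)) ∧
      ∃ C : ℝ, 0 < C ∧ ∀ β ∈ Set.Ioo (-β₀) β₀, ‖U β - u‖ ≤ C * |β|) := by
  have : Fact (0 < L) := ⟨hL⟩
  have hu1 : extend (rep 1 u) L = 0 := ((mem_stateSpace_iff hζ c₀ u).1 hu.1).2.1
  have hne := endpoint_slope_ne_zero hζ c₀ hu hE
  have hA : HasFDerivAt (fun h : tangentSpace L => steadyOp hζ c₀ (u + (h : Sobolev 4 L)) 0)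
      (linEquiv c₀ hne hu1 : tangentSpace L →L[ℝ] L2 L) 0 := hasFDerivAt_steadyOp_add hζ c₀
  refine ⟨fun h hd h0 => eq_zero_of_linPot_eq_zero c₀ hne hd h0,
    ⟨linEquiv c₀ hne hu1, hA, fun h => ?_, fun h h0 => ?_⟩,
    exists_branch hζ c₀ (linEquiv c₀ hne hu1) hA hu⟩
  · obtain ⟨p, p0, -, p2⟩ := exists_linPot c₀ u h
    refine ⟨p, ?_, p2.symm⟩
    rw [p0]
    exact (linPot_ae_eq c₀ u (coeFn_wd_castSucc 0 (h : Sobolev 4 L))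
      (Filter.EventuallyEq.refl _ _)).symm
  · exact (linEquiv c₀ hne hu1).map_eq_zero_iff.1 h0
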